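/- Let $\mathbb D=\{x\in\mathbb R^2:|x|<1\}$. For $\Omega\subset\mathbb R^2$ and $z=u+\mathrm i v:\Omega\to\mathbb C$ write $\langle\nabla z,\nabla z\rangle=|\nabla u|^2+|\nabla v|^2$, $\langle z,\triangle z\rangle=u\triangle u+v\triangle v$, $$E_\Omega(z)=\int_\Omega\frac{2\langle\nabla z,\nabla z\rangle}{(1+|z|^2)^2}\,dx,\qquad \mathcal E_\Omega(z)=-\int_\Omega\Big\langle\nabla\frac{2}{(1+|z|^2)^2},\,u\nabla u+v\nabla v\Big\rangle dx-\int_\Omega\frac{2\langle z,\triangle z\rangle}{(1+|z|^2)^2}\,dx .$$ Thus $\mathcal E_\Omega$ is the Dirichlet energy $E_\Omega$ after integration by parts with the boundary integral omitted. Put $E_S=E_{\mathbb D}$ and $E_N=E_{\mathbb R^2\setminus\mathbb D}$, and $\mathcal E_S$, $\mathcal E_N$ likewise. **Theorem.** Let $\underline z_c:\mathbb R^2\setminus\mathbb D\to\mathbb C\setminus\{0\}$ be $C^2$ (up to the unit circle) with $E_N(\underline z_c)<\infty$, and let it be a critical point of $E_N$: $\frac{d}{dt}E_N(\underline z_c+t\varphi)|_{t=0}=0$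 for all smooth $\varphi$ with compact support in $\{|x|>1\}$. Let $\zeta=1/\overline{\underline z_c}=\mu+\mathrm i\nu$. Then: 1. On $\{|x|>1\}$ the pair $(\mathbf u,\mathbf v)=(\mu,\nu)$ satisfies the Euler–Lagrange equations $$-\triangle\mathbf u=\frac{-2\mathbf u|\nabla\mathbf u|^2+2\mathbf u|\nabla\mathbf v|^2-4\mathbf v\langle\nabla\mathbf u,\nabla\mathbf v\rangle}{1+\mathbf u^2+\mathbf v^2},\qquad -\triangle\mathbf v=\frac{-2\mathbf v|\nabla\mathbf v|^2+2\mathbf v|\nabla\mathbf u|^2-4\mathbf u\langle\nabla\mathbf u,\nabla\mathbf v\rangle}{1+\mathbf u^2+\mathbf v^2}.$$ 2. All the integrals below converge, $E_N(\zeta)=E_N(\underline z_c)$, and $$E_N(\zeta)=\mathcal E_N(\underline z_c)-\oint_{|x|=1}\frac{2\langle\underline z_c,\partial_r\underline z_c\rangle}{(1+|\underline z_c|^2)^2}\,ds,$$ where $\mathcal E_N(\underline z_c)$, the northern energy without its boundary integral, has the decomposition $$\mathcal E_N(\underline z_c)=\int_{\mathbb R^2\setminus\mathbb D}\frac{-|\nabla\ln(1+|\zeta|^2)|^2}{1+|\zeta|^2}\,dx+\int_{\mathbb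 R^2\setminus\mathbb D}\frac{4\langle\nabla\zeta,\nabla\zeta\rangle}{(1+|\zeta|^2)^2}\,dx-\int_{\mathbb R^2\setminus\mathbb D}\frac{4}{1+|\zeta|^2}\,\frac{\mu^2|\nabla\nu|^2-2\mu\nu\langle\nabla\mu,\nabla\nu\rangle+\nu^2|\nabla\mu|^2}{(1+|\zeta|^2)^2}\,dx .$$ The boundary integrals cancel in the total energy: if $z$ is $C^2$ on $\overline{\mathbb D}$ and $z=\underline z_c$, $\partial_r z=\partial_r\underline z_c$ on the unit circle, then $E_S(z)+E_N(\zeta)$ equals $\mathcal E_S(z)$ plus the right-hand side of the last formula. 3. Suppose moreover that almost everywhere $\mu^2|\nabla\nu|^2=\nu^2|\nabla\mu|^2$ and $\nabla\mu,\nabla\nu$ are linearly dependent (the minimal conditions). Then $\zeta$ minimizes $E_N$ among all maps $\eta:\mathbb R^2\setminus\mathbb D\to\mathbb C$ that are continuous, $C^1$ on $\{|x|>1\}$, of finite energy and equal to $\zeta$ on the unit circle. Also $$\mathcal E_N(\underline z_c)=-\int_{\mathbb R^2\setminus\mathbb D}\frac{|\nabla\ln(1+|\zeta|^2)|^2}{1+|\zeta|^2}\,dx+\int_{\mathbb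 R^2\setminus\mathbb D}\frac{4\langle\nabla\zeta,\nabla\zeta\rangle}{(1+|\zeta|^2)^2}\,dx ,$$ and the minimal value $E_N(\zeta)$ equals this right-hand side minus the boundary integral in 2. -/

import Mathlib

open MeasureTheory

noncomputable section

/-- The Euclidean plane `ℝ²`. -/
abbrev Plane : Type := EuclideanSpace ℝ (Fin 2)

/-- The open unit disk `𝔻`. -/
def unitDisk : Set Plane := Metric.ball 0 1

/-- The northern domain `ℝ² \ 𝔻`, with its boundary circle. -/
def northDomain : Set Plane := unitDiskᶜ

/-- The interior `{1 < |x|}` of the northern domain. -/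
def northInterior : Set Plane := (Metric.closedBall (0 : Plane) 1)ᶜ

/-- The first component `u` of `z = u + i v`. -/
def uPart (z : Plane → ℂ) : Plane → ℝ := fun x => (z x).re

/-- The second component `v` of `z = u + i v`. -/
def vPart (z : Plane → ℂ) : Plane → ℝ := fun x => (z x).im

/-- The partial derivative `f_{x^{i+1}}`. -/
def partialD (i : Fin 2) (f : Plane → ℝ) (x : Plane) : ℝ :=
  fderiv ℝ f x (EuclideanSpace.single i 1)

/-- `⟨∇z, ∇z⟩ = |∇u|² + |∇v|²`. -/
def gradSq (z : Plane → ℂ) (x : Plane) : ℝ :=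
  ‖gradient (uPart z) x‖ ^ 2 + ‖gradient (vPart z) x‖ ^ 2

/-- `2 ⟨∇z, ∇z⟩ / (1 + |z|²)²`, the Dirichlet energy density of `z` for the spherical metric
`4 (du² + dv²) / (1 + u² + v²)²` on the target. -/
def energyDensity (z : Plane → ℂ) (x : Plane) : ℝ :=
  2 * gradSq z x / (1 + ‖z x‖ ^ 2) ^ 2

/-- The Dirichlet energy of `z` on `Ω`. -/
def dirichletEnergy (Ω : Set Plane) (z : Plane → ℂ) : ℝ :=
  ∫ x in Ω, energyDensity z x

/-- The southern energy `E_S`. -/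
def energyS (z : Plane → ℂ) : ℝ := dirichletEnergy unitDisk z

/-- The northern energy `E_N`. -/
def energyN (z : Plane → ℂ) : ℝ := dirichletEnergy northDomain z

/-- `z` is a critical point of `E_N`: the first variation vanishes in the direction of every
smooth `φ` with compact support inside the northern domain. -/
def IsCriticalN (z : Plane → ℂ) : Prop :=
  ∀ φ : Plane → ℂ, ContDiff ℝ (⊤ : ℕ∞) φ → HasCompactSupport φ → tsupport φ ⊆ northInterior →
    HasDerivAt (fun t : ℝ => energyN (fun x => z x + t • φ x)) 0 0

/-- The integrand `⟨∇(2 / (1 + |z|²)²), u ∇u + v ∇v⟩`. -/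
def partsFirst (z : Plane → ℂ) (x : Plane) : ℝ :=
  inner ℝ (gradient (fun y => 2 / (1 + ‖z y‖ ^ 2) ^ 2) x)
    (uPart z x • gradient (uPart z) x + vPart z x • gradient (vPart z) x)

/-- The integrand `2 ⟨z, Δz⟩ / (1 + |z|²)²`. -/
def partsSecond (z : Plane → ℂ) (x : Plane) : ℝ :=
  2 * (uPart z x * Laplacian.laplacian (uPart z) x
    + vPart z x * Laplacian.laplacian (vPart z) x) / (1 + ‖z x‖ ^ 2) ^ 2

/-- The energy after integration by parts, with the boundary integral omitted. -/
def energyByParts (Ω : Set Plane) (z : Plane → ℂ) : ℝ :=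
  -(∫ x in Ω, partsFirst z x) - ∫ x in Ω, partsSecond z x

/-- The point `(cos θ, sin θ)`. -/
def circlePt (θ : ℝ) : Plane := !₂[Real.cos θ, Real.sin θ]

/-- The boundary integral `∮_{|x| = 1} 2 ⟨z, ∂_r z⟩ / (1 + |z|²)² ds`, where the radial derivative
`∂_r z` is taken from inside `Ω` (on the unit circle the radial unit vector at `x` is `x`). -/
def circleTerm (Ω : Set Plane) (z : Plane → ℂ) : ℝ :=
  ∫ θ in (0 : ℝ)..(2 * Real.pi),
    2 * inner ℝ (z (circlePt θ)) (fderivWithin ℝ z Ω (circlePt θ) (circlePt θ))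
      / (1 + ‖z (circlePt θ)‖ ^ 2) ^ 2

/-- The Euler–Lagrange equations for the pair `(u, v)` at the point `x`. -/
def EulerLagrangeAt (u v : Plane → ℝ) (x : Plane) : Prop :=
  -Laplacian.laplacian u x =
      (-2 * u x * partialD 0 u x ^ 2 - 2 * u x * partialD 1 u x ^ 2
        + 2 * u x * partialD 0 v x ^ 2 + 2 * u x * partialD 1 v x ^ 2
        - 4 * partialD 0 u x * partialD 0 v x * v x
        - 4 * partialD 1 u x * partialD 1 v x * v x) / (1 + u x ^ 2 + v x ^ 2) ∧
  -Laplacian.laplacian v x =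
      (-2 * v x * partialD 0 v x ^ 2 - 2 * v x * partialD 1 v x ^ 2
        + 2 * v x * partialD 0 u x ^ 2 + 2 * v x * partialD 1 u x ^ 2
        - 4 * partialD 0 u x * partialD 0 v x * u x
        - 4 * partialD 1 u x * partialD 1 v x * u x) / (1 + u x ^ 2 + v x ^ 2)

/-- The minimal conditions for the pair `(u, v)` at the point `x`. -/
def MinimalConditionsAt (u v : Plane → ℝ) (x : Plane) : Prop :=
  u x ^ 2 * ‖gradient v x‖ ^ 2 = v x ^ 2 * ‖gradient u x‖ ^ 2 ∧
  ¬ LinearIndependent ℝ ![gradient u x, gradient v x]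

/-- The inverted map `1 / conj z`. -/
def inverted (z : Plane → ℂ) : Plane → ℂ := fun x => 1 / (starRingEnd ℂ) (z x)

/-- The integrand `|∇ ln (1 + |ζ|²)|² / (1 + |ζ|²)`. -/
def logTerm (ζ : Plane → ℂ) (x : Plane) : ℝ :=
  ‖gradient (fun y => Real.log (1 + ‖ζ y‖ ^ 2)) x‖ ^ 2 / (1 + ‖ζ x‖ ^ 2)

/-- The integrand `4 ⟨∇ζ, ∇ζ⟩ / (1 + |ζ|²)²`. -/
def gradTerm (ζ : Plane → ℂ) (x : Plane) : ℝ :=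
  4 * gradSq ζ x / (1 + ‖ζ x‖ ^ 2) ^ 2

/-- The integrand
`4 / (1 + |ζ|²) * (μ² |∇ν|² - 2 μ ν ⟨∇μ, ∇ν⟩ + ν² |∇μ|²) / (1 + |ζ|²)²` for `ζ = μ + i ν`. -/
def crossTerm (ζ : Plane → ℂ) (x : Plane) : ℝ :=
  4 / (1 + ‖ζ x‖ ^ 2) *
    ((uPart ζ x ^ 2 * ‖gradient (vPart ζ) x‖ ^ 2
      - 2 * uPart ζ x * vPart ζ x * inner ℝ (gradient (uPart ζ) x) (gradient (vPart ζ) x)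
      + vPart ζ x ^ 2 * ‖gradient (uPart ζ) x‖ ^ 2) / (1 + ‖ζ x‖ ^ 2) ^ 2)

/-- The maps of finite northern energy with the same boundary values as `ζ` on the unit circle:
`C¹` in the interior of the northern domain and continuous up to the circle. -/
def competitorsN (ζ : Plane → ℂ) : Set (Plane → ℂ) :=
  {η | ContinuousOn η northDomain ∧ ContDiffOn ℝ 1 η northInterior ∧
    IntegrableOn (energyDensity η) northDomain ∧
    ∀ x ∈ Metric.sphere (0 : Plane) 1, η x = ζ x}

end

/-!
A critical point of the energy is a harmonic map into the round sphere in stereographic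
coordinates. The inversion `z ↦ 1 / z̄` is an isometry of the sphere, so `ζ` is harmonic with the
same energy density. The energy by parts differs from the energy by the integral of the
divergence of the square integrable field `∇|z|² / (1 + |z|²)²`; square integrability makes its
flux through large circles negligible, which leaves only the flux through the unit circle.

The minimal conditions and the harmonic map equation together force the angular part of `∇ζ` to
vanish: `ζ` moves along meridians, and its spherical distance `Φ(ζ)` to the pole is a harmonic
function. For every competitor `η`, the pairing `⟨∇Φ(η), ∇Φ(ζ)⟩` is bounded by the mean of the two
energy densities, with equality for `η = ζ`. Since its integral is a flux through the unit circle,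
where `η = ζ`, the field `∇Φ(ζ)` calibrates `ζ`.
-/

noncomputable section

open Set Filter Topology ComplexConjugate

section VectorCalculus

variable {ι : Type*} [DecidableEq ι] {G : Type*} [NormedAddCommGroup G]
  [InnerProductSpace ℝ G] {x : EuclideanSpace ℝ ι}

/-- The partial derivative `∂ᵢ f` of a vector valued function. -/
def partialDeriv (i : ι) (f : EuclideanSpace ℝ ι → G) (x : EuclideanSpace ℝ ι) : G :=
  fderiv ℝ f x (EuclideanSpace.single i 1)

/-- The vector field `(Dz)ᵀ φ`, whose `i`-th component is `⟪∂ᵢ z, φ⟫`. The derivative of `z` is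
taken from inside `K`, so that the field makes sense on the boundary of `K`. -/
def adjointDeriv (K : Set (EuclideanSpace ℝ ι)) (z φ : EuclideanSpace ℝ ι → G)
    (x : EuclideanSpace ℝ ι) : EuclideanSpace ℝ ι :=
  WithLp.toLp 2 fun i => inner ℝ (fderivWithin ℝ z K x (EuclideanSpace.single i 1)) (φ x)

variable {K : Set (EuclideanSpace ℝ ι)} {z φ : EuclideanSpace ℝ ι → G}

theorem adjointDeriv_apply_of_mem_nhds (hK : K ∈ 𝓝 x) (i : ι) :
    adjointDeriv K z φ x i = inner ℝ (partialDeriv i z x) (φ x) := by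
  simp only [adjointDeriv, partialDeriv, fderivWithin_of_mem_nhds hK]

theorem adjointDeriv_eventuallyEq (hK : K ∈ 𝓝 x) :
    adjointDeriv K z φ =ᶠ[𝓝 x]
      fun y => WithLp.toLp 2 fun i => inner ℝ (partialDeriv i z y) (φ y) := by
  filter_upwards [eventually_mem_nhds_iff.2 hK] with y hy
  ext i
  exact adjointDeriv_apply_of_mem_nhds hy i

variable [Fintype ι]

/-- The divergence `∑ᵢ ∂ᵢ Fᵢ` of a vector field. -/
def divergence (F : EuclideanSpace ℝ ι → EuclideanSpace ℝ ι) (x : EuclideanSpace ℝ ι) : ℝ :=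
  ∑ i, partialDeriv i F x i

theorem sum_smul_single (v : EuclideanSpace ℝ ι) :
    ∑ i, v i • EuclideanSpace.single i (1 : ℝ) = v := by
  simpa using (EuclideanSpace.basisFun ι ℝ).sum_repr v

theorem map_eq_sum_smul_single (L : EuclideanSpace ℝ ι →L[ℝ] G) (v : EuclideanSpace ℝ ι) :
    L v = ∑ i, v i • L (EuclideanSpace.single i 1) := by
  simp only [← map_smul, ← map_sum, sum_smul_single]

theorem gradient_apply (f : EuclideanSpace ℝ ι → ℝ) (x : EuclideanSpace ℝ ι) (i : ι) :
    gradient f x i = partialDeriv i f x := by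
  rw [partialDeriv, ← inner_gradient_left, EuclideanSpace.inner_single_right]
  simp

theorem norm_sq_gradient (f : EuclideanSpace ℝ ι → ℝ) (x : EuclideanSpace ℝ ι) :
    ‖gradient f x‖ ^ 2 = ∑ i, partialDeriv i f x ^ 2 := by
  simp only [EuclideanSpace.real_norm_sq_eq, gradient_apply]

theorem inner_gradient (f g : EuclideanSpace ℝ ι → ℝ) (x : EuclideanSpace ℝ ι) :
    inner ℝ (gradient f x) (gradient g x) = ∑ i, partialDeriv i f x * partialDeriv i g x := by
  simp only [PiLp.inner_apply, gradient_apply, RCLike.inner_apply, conj_trivial, mul_comm]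

theorem partialDeriv_component {F : EuclideanSpace ℝ ι → EuclideanSpace ℝ ι}
    (hF : DifferentiableAt ℝ F x) (i j : ι) :
    partialDeriv i (fun y => F y j) x = partialDeriv i F x j := by
  have hd : HasFDerivAt (fun y => F y j) _ x :=
    (EuclideanSpace.proj (𝕜 := ℝ) j).hasFDerivAt.comp x hF.hasFDerivAt
  rw [partialDeriv, hd.fderiv]
  rfl

theorem contDiffAt_partialDeriv {f : EuclideanSpace ℝ ι → G} (hf : ContDiffAt ℝ 2 f x) (i : ι) :
    ContDiffAt ℝ 1 (partialDeriv i f) x :=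
  (hf.fderiv_right (m := 1) (by norm_num)).clm_apply contDiffAt_const

theorem laplacian_eq_sum_partialDeriv {f : EuclideanSpace ℝ ι → G} (hf : ContDiffAt ℝ 2 f x) :
    Laplacian.laplacian f x = ∑ i, partialDeriv i (partialDeriv i f) x := by
  have hd : DifferentiableAt ℝ (fderiv ℝ f) x :=
    (hf.fderiv_right (m := 1) (by norm_num)).differentiableAt one_ne_zero
  rw [InnerProductSpace.laplacian_eq_iteratedFDeriv_orthonormalBasis f
    (EuclideanSpace.basisFun ι ℝ)]
  refine Finset.sum_congr rfl fun i _ => ?_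
  rw [iteratedFDeriv_two_apply, partialDeriv,
    show partialDeriv i f = fun y => fderiv ℝ f y (EuclideanSpace.single i 1) from rfl,
    fderiv_clm_apply hd (differentiableAt_const _)]
  simp

theorem divergence_smul {f : EuclideanSpace ℝ ι → ℝ}
    {F : EuclideanSpace ℝ ι → EuclideanSpace ℝ ι} (hf : DifferentiableAt ℝ f x)
    (hF : DifferentiableAt ℝ F x) :
    divergence (fun y => f y • F y) x
      = inner ℝ (gradient f x) (F x) + f x * divergence F x := by
  simp only [divergence, partialDeriv, fderiv_fun_smul hf hF, PiLp.inner_apply, gradient_apply,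
    Finset.mul_sum, ← Finset.sum_add_distrib]
  refine Finset.sum_congr rfl fun i _ => ?_
  simp
  ring

theorem inner_adjointDeriv (v : EuclideanSpace ℝ ι) :
    inner ℝ (adjointDeriv K z φ x) v = inner ℝ (fderivWithin ℝ z K x v) (φ x) := by
  rw [map_eq_sum_smul_single (fderivWithin ℝ z K x) v, sum_inner]
  simp [adjointDeriv, PiLp.inner_apply, inner_smul_left]

theorem norm_sq_adjointDeriv (hK : K ∈ 𝓝 x) :
    ‖adjointDeriv K z φ x‖ ^ 2 = ∑ i, inner ℝ (partialDeriv i z x) (φ x) ^ 2 := by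
  simp only [EuclideanSpace.real_norm_sq_eq, adjointDeriv_apply_of_mem_nhds hK]

theorem continuousOn_adjointDeriv (hK : UniqueDiffOn ℝ K) (hz : ContDiffOn ℝ 1 z K)
    (hφ : ContinuousOn φ K) : ContinuousOn (adjointDeriv K z φ) K := by
  refine (PiLp.continuous_toLp 2 _).comp_continuousOn (continuousOn_pi.2 fun i => ?_)
  exact ((hz.continuousOn_fderivWithin hK le_rfl).clm_apply continuousOn_const).inner hφ

theorem differentiableAt_adjointDeriv (hK : K ∈ 𝓝 x) (hz : ContDiffAt ℝ 2 z x)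
    (hφ : DifferentiableAt ℝ φ x) : DifferentiableAt ℝ (adjointDeriv K z φ) x := by
  refine DifferentiableAt.congr_of_eventuallyEq ?_ (adjointDeriv_eventuallyEq hK)
  refine (differentiableAt_piLp 2).2 fun i => ?_
  exact ((contDiffAt_partialDeriv hz i).differentiableAt one_ne_zero).inner ℝ hφ

theorem divergence_adjointDeriv (hK : K ∈ 𝓝 x) (hz : ContDiffAt ℝ 2 z x)
    (hφ : DifferentiableAt ℝ φ x) :
    divergence (adjointDeriv K z φ) x = inner ℝ (Laplacian.laplacian z x) (φ x)
      + ∑ i, inner ℝ (partialDeriv i z x) (partialDeriv i φ x) := by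
  rw [laplacian_eq_sum_partialDeriv hz, sum_inner, ← Finset.sum_add_distrib, divergence]
  refine Finset.sum_congr rfl fun i _ => ?_
  have hd := (contDiffAt_partialDeriv hz i).differentiableAt one_ne_zero
  have hcomp : (fun y => adjointDeriv K z φ y i)
      =ᶠ[𝓝 x] fun y => inner ℝ (partialDeriv i z y) (φ y) :=
    (adjointDeriv_eventuallyEq hK).fun_comp fun v => v i
  rw [← partialDeriv_component (differentiableAt_adjointDeriv hK hz hφ), partialDeriv,
    hcomp.fderiv_eq, fderiv_inner_apply ℝ hd hφ, add_comm]
  rfl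

theorem gradient_comp_norm_sq {h : ℝ → ℝ} {h' : ℝ} (hK : K ∈ 𝓝 x) (hz : DifferentiableAt ℝ z x)
    (hh : HasDerivAt h h' (‖z x‖ ^ 2)) :
    gradient (fun y => h (‖z y‖ ^ 2)) x = (2 * h') • adjointDeriv K z z x := by
  have hd : HasFDerivAt (fun y => h (‖z y‖ ^ 2)) _ x :=
    hh.comp_hasFDerivAt x hz.hasFDerivAt.norm_sq
  ext i
  rw [gradient_apply, partialDeriv, hd.fderiv, PiLp.smul_apply, adjointDeriv_apply_of_mem_nhds hK,
    partialDeriv, real_inner_comm]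
  simp
  ring

end VectorCalculus

section PolarCoordinates

/-- The point of the plane with polar coordinates `p = (r, θ)`. -/
def polarPt (p : ℝ × ℝ) : Plane := p.1 • circlePt p.2

/-- The unit tangent vector `(-sin θ, cos θ)` of the unit circle at `circlePt θ`. -/
def circleTangent (θ : ℝ) : Plane := !₂[-Real.sin θ, Real.cos θ]

/-- The open annulus `{a < |x| < b}`, which is a punctured disk if `a = 0`. -/
def annulus (a b : ℝ) : Set Plane := {x | a < ‖x‖ ∧ ‖x‖ < b}

/-- The identification of `ℝ × ℝ` with the Euclidean plane. -/
def planeEquiv : ℝ × ℝ ≃ᵐ Plane :=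
  MeasurableEquiv.finTwoArrow.symm.trans (MeasurableEquiv.toLp 2 (Fin 2 → ℝ))

theorem measurePreserving_planeEquiv : MeasurePreserving planeEquiv :=
  (EuclideanSpace.volume_preserving_symm_measurableEquiv_toLp (Fin 2)).symm.comp
    (volume_preserving_finTwoArrow ℝ).symm

theorem planeEquiv_polarCoord_symm (p : ℝ × ℝ) : planeEquiv (polarCoord.symm p) = polarPt p := by
  ext i
  fin_cases i <;> simp [planeEquiv, polarPt, circlePt]

theorem norm_circlePt (θ : ℝ) : ‖circlePt θ‖ = 1 := by
  simp [EuclideanSpace.norm_eq, circlePt, Fin.sum_univ_two]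

theorem norm_polarPt (p : ℝ × ℝ) : ‖polarPt p‖ = |p.1| := by
  simp [polarPt, norm_smul, norm_circlePt]

theorem hasDerivAt_vecTwo {f g : ℝ → ℝ} {f' g' t : ℝ} (hf : HasDerivAt f f' t)
    (hg : HasDerivAt g g' t) : HasDerivAt (fun s => (!₂[f s, g s] : Plane)) !₂[f', g'] t := by
  have h : HasDerivAt (fun s => ![f s, g s]) ![f', g'] t :=
    hasDerivAt_pi.2 (Fin.forall_fin_two.2 ⟨hf, hg⟩)
  exact (PiLp.hasFDerivAt_toLp 2 _).comp_hasDerivAt t h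

theorem hasDerivAt_circlePt (θ : ℝ) : HasDerivAt circlePt (circleTangent θ) θ :=
  hasDerivAt_vecTwo (Real.hasDerivAt_cos θ) (Real.hasDerivAt_sin θ)

theorem hasDerivAt_circleTangent (θ : ℝ) : HasDerivAt circleTangent (-circlePt θ) θ := by
  have h : -circlePt θ = !₂[-Real.cos θ, -Real.sin θ] := by ext i; fin_cases i <;> rfl
  rw [h]
  exact hasDerivAt_vecTwo (Real.hasDerivAt_sin θ).neg (Real.hasDerivAt_cos θ)

theorem differentiable_circlePt : Differentiable ℝ circlePt :=
  fun θ => (hasDerivAt_circlePt θ).differentiableAt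

theorem differentiable_circleTangent : Differentiable ℝ circleTangent :=
  fun θ => (hasDerivAt_circleTangent θ).differentiableAt

theorem differentiable_polarPt : Differentiable ℝ polarPt :=
  differentiable_fst.fun_smul (differentiable_circlePt.comp differentiable_snd)

theorem integral_polarPt (f : Plane → ℝ) :
    ∫ p in polarCoord.target, p.1 * f (polarPt p) = ∫ x, f x := by
  rw [← measurePreserving_planeEquiv.integral_comp planeEquiv.measurableEmbedding,
    ← integral_comp_polarCoord_symm]
  simp only [planeEquiv_polarCoord_symm, smul_eq_mul]

theorem integrableOn_polarPt {f : Plane → ℝ} (hf : Integrable f) :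
    IntegrableOn (fun p => p.1 * f (polarPt p)) polarCoord.target := by
  have h : IntegrableOn (fun p => f (planeEquiv p)) (polarCoord.symm '' polarCoord.target) :=
    ((measurePreserving_planeEquiv.integrable_comp_emb planeEquiv.measurableEmbedding).2
      hf).integrableOn
  rw [integrableOn_image_iff_integrableOn_abs_det_fderiv_smul volume
    polarCoord.open_target.measurableSet
    (fun p _ => (hasFDerivAt_polarCoord_symm p).hasFDerivWithinAt) polarCoord.symm.injOn] at h
  refine h.congr_fun (fun p hp => ?_) polarCoord.open_target.measurableSet
  simp only [det_fderivPolarCoordSymm, planeEquiv_polarCoord_symm, smul_eq_mul,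
    abs_of_pos (show 0 < p.1 from hp.1)]

theorem mul_indicator_polarPt (s : Set Plane) (f : Plane → ℝ) :
    (fun p : ℝ × ℝ => p.1 * s.indicator f (polarPt p))
      = (polarPt ⁻¹' s).indicator fun p => p.1 * f (polarPt p) := by
  ext p
  by_cases h : polarPt p ∈ s
  · rw [indicator_of_mem h, indicator_of_mem (show p ∈ polarPt ⁻¹' s from h)]
  · rw [indicator_of_notMem h, indicator_of_notMem (show p ∉ polarPt ⁻¹' s from h), mul_zero]

theorem setIntegral_polarPt {s : Set Plane} (hs : MeasurableSet s) (f : Plane → ℝ) :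
    ∫ p in polarCoord.target ∩ polarPt ⁻¹' s, p.1 * f (polarPt p) = ∫ x in s, f x := by
  rw [← integral_indicator hs, ← integral_polarPt, mul_indicator_polarPt,
    setIntegral_indicator (differentiable_polarPt.continuous.measurable hs)]

theorem integrableOn_inter_preimage_polarPt {s : Set Plane} (hs : MeasurableSet s)
    {f : Plane → ℝ} (hf : IntegrableOn f s) :
    IntegrableOn (fun p => p.1 * f (polarPt p)) (polarCoord.target ∩ polarPt ⁻¹' s) := by
  have h := integrableOn_polarPt (hf.integrable_indicator hs)
  have hs' := differentiable_polarPt.continuous.measurable hs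
  rwa [mul_indicator_polarPt, IntegrableOn, integrable_indicator_iff hs', IntegrableOn,
    Measure.restrict_restrict hs', inter_comm] at h

theorem isOpen_annulus (a b : ℝ) : IsOpen (annulus a b) :=
  (isOpen_lt continuous_const continuous_norm).inter (isOpen_lt continuous_norm continuous_const)

theorem polarCoord_target_inter_preimage_annulus {a b : ℝ} (ha : 0 ≤ a) :
    polarCoord.target ∩ polarPt ⁻¹' annulus a b = Ioo a b ×ˢ Ioo (-Real.pi) Real.pi := by
  ext p
  simp only [polarCoord_target, annulus, mem_inter_iff, mem_prod, mem_Ioi, mem_preimage,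
    mem_ofPred_eq, norm_polarPt, mem_Ioo]
  constructor
  · rintro ⟨⟨hr, hθ⟩, hp⟩
    rw [abs_of_pos hr] at hp
    exact ⟨hp, hθ⟩
  · rintro ⟨hp, hθ⟩
    have hr : 0 < p.1 := ha.trans_lt hp.1
    rw [abs_of_pos hr]
    exact ⟨⟨hr, hθ⟩, hp⟩

end PolarCoordinates

section DivergenceTheorem

/-- `r ⟪F, e_r⟫` in polar coordinates, with `e_r` the radial unit vector. -/
def polarRadial (F : Plane → Plane) (p : ℝ × ℝ) : ℝ :=
  p.1 * inner ℝ (F (polarPt p)) (circlePt p.2)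

/-- `⟪F, e_θ⟫` in polar coordinates, with `e_θ` the angular unit vector. -/
def polarAngular (F : Plane → Plane) (p : ℝ × ℝ) : ℝ :=
  inner ℝ (F (polarPt p)) (circleTangent p.2)

/-- The outward flux of a vector field through the circle of radius `r`. -/
def flux (F : Plane → Plane) (r : ℝ) : ℝ := ∫ θ in -Real.pi..Real.pi, polarRadial F (r, θ)

variable {F : Plane → Plane}

/-- The divergence is a trace, hence may be computed in the orthonormal frame `e_r, e_θ`. -/
theorem divergence_eq_inner_circlePt_add (F : Plane → Plane) (x : Plane) (θ : ℝ) :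
    divergence F x = inner ℝ (fderiv ℝ F x (circlePt θ)) (circlePt θ)
      + inner ℝ (fderiv ℝ F x (circleTangent θ)) (circleTangent θ) := by
  rw [map_eq_sum_smul_single (fderiv ℝ F x) (circlePt θ),
    map_eq_sum_smul_single (fderiv ℝ F x) (circleTangent θ)]
  simp only [divergence, partialDeriv, circlePt, circleTangent, PiLp.inner_apply,
    Fin.sum_univ_two, RCLike.inner_apply, conj_trivial, PiLp.add_apply, PiLp.smul_apply,
    smul_eq_mul, PiLp.toLp_apply, Matrix.cons_val_zero, Matrix.cons_val_one]
  linear_combination -(fderiv ℝ F x (EuclideanSpace.single 0 1) 0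
    + fderiv ℝ F x (EuclideanSpace.single 1 1) 1) * Real.sin_sq_add_cos_sq θ

theorem differentiableAt_polarRadial {p : ℝ × ℝ} (hF : DifferentiableAt ℝ F (polarPt p)) :
    DifferentiableAt ℝ (polarRadial F) p :=
  differentiableAt_fst.fun_mul ((hF.comp p (differentiable_polarPt p)).inner ℝ
    ((differentiable_circlePt p.2).comp p differentiableAt_snd))

theorem differentiableAt_polarAngular {p : ℝ × ℝ} (hF : DifferentiableAt ℝ F (polarPt p)) :
    DifferentiableAt ℝ (polarAngular F) p :=
  (hF.comp p (differentiable_polarPt p)).inner ℝ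
    ((differentiable_circleTangent p.2).comp p differentiableAt_snd)

theorem hasDerivAt_polarRadial_fst {r θ : ℝ} (hF : DifferentiableAt ℝ F (polarPt (r, θ))) :
    HasDerivAt (fun s => polarRadial F (s, θ))
      (inner ℝ (F (polarPt (r, θ))) (circlePt θ)
        + r * inner ℝ (fderiv ℝ F (polarPt (r, θ)) (circlePt θ)) (circlePt θ)) r := by
  have hP : HasDerivAt (fun s : ℝ => polarPt (s, θ)) (circlePt θ) r := by
    simpa [polarPt] using (hasDerivAt_id r).smul_const (circlePt θ)
  have h := (hasDerivAt_id r).fun_mul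
    ((hF.hasFDerivAt.comp_hasDerivAt r hP).inner ℝ (hasDerivAt_const r (circlePt θ)))
  simpa [polarRadial] using h

theorem hasDerivAt_polarAngular_snd {r θ : ℝ} (hF : DifferentiableAt ℝ F (polarPt (r, θ))) :
    HasDerivAt (fun t => polarAngular F (r, t))
      (r * inner ℝ (fderiv ℝ F (polarPt (r, θ)) (circleTangent θ)) (circleTangent θ)
        - inner ℝ (F (polarPt (r, θ))) (circlePt θ)) θ := by
  have hP : HasDerivAt (fun t : ℝ => polarPt (r, t)) (r • circleTangent θ) θ :=
    (hasDerivAt_circlePt θ).const_smul r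
  have h := (hF.hasFDerivAt.comp_hasDerivAt θ hP).inner ℝ (hasDerivAt_circleTangent θ)
  refine h.congr_deriv ?_
  simp only [Function.comp_apply, map_smul, inner_smul_left, inner_neg_right, conj_trivial]
  ring

theorem fderiv_polarRadial_add_fderiv_polarAngular {p : ℝ × ℝ}
    (hF : DifferentiableAt ℝ F (polarPt p)) :
    fderiv ℝ (polarRadial F) p (1, 0) + fderiv ℝ (polarAngular F) p (0, 1)
      = p.1 * divergence F (polarPt p) := by
  obtain ⟨r, θ⟩ := p
  have hr : HasDerivAt (fun s : ℝ => (s, θ)) (1, 0) r :=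
    (hasDerivAt_id r).prodMk (hasDerivAt_const r θ)
  have hθ : HasDerivAt (fun t : ℝ => (r, t)) (0, 1) θ :=
    (hasDerivAt_const θ r).prodMk (hasDerivAt_id θ)
  have hradial := (differentiableAt_polarRadial hF).hasFDerivAt.comp_hasDerivAt r hr
  have hangular := (differentiableAt_polarAngular hF).hasFDerivAt.comp_hasDerivAt θ hθ
  rw [hradial.unique (hasDerivAt_polarRadial_fst hF),
    hangular.unique (hasDerivAt_polarAngular_snd hF), divergence_eq_inner_circlePt_add F _ θ]
  ring

theorem polarAngular_neg_pi (F : Plane → Plane) (r : ℝ) :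
    polarAngular F (r, -Real.pi) = polarAngular F (r, Real.pi) := by
  simp [polarAngular, polarPt, circlePt, circleTangent]

theorem Icc_ae_eq_Ioo_prod (a b c d : ℝ) :
    (Icc (a, c) (b, d) : Set (ℝ × ℝ)) =ᵐ[volume] Ioo a b ×ˢ Ioo c d := by
  rw [← Icc_prod_Icc]
  exact (Measure.set_prod_ae_eq Ioo_ae_eq_Icc Ioo_ae_eq_Icc).symm

theorem continuousOn_polarRadial {s : Set Plane} (hF : ContinuousOn F s) :
    ContinuousOn (polarRadial F) (polarPt ⁻¹' s) :=
  continuous_fst.continuousOn.mul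
    ((hF.comp differentiable_polarPt.continuous.continuousOn (mapsTo_preimage _ _)).inner
      (differentiable_circlePt.continuous.comp continuous_snd).continuousOn)

theorem continuousOn_polarAngular {s : Set Plane} (hF : ContinuousOn F s) :
    ContinuousOn (polarAngular F) (polarPt ⁻¹' s) :=
  (hF.comp differentiable_polarPt.continuous.continuousOn (mapsTo_preimage _ _)).inner
    (differentiable_circleTangent.continuous.comp continuous_snd).continuousOn

theorem integral_divergence_annulus {a b : ℝ} (ha : 0 ≤ a) (hab : a ≤ b)
    (hF : ContinuousOn F {x | a ≤ ‖x‖ ∧ ‖x‖ ≤ b})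
    (hdF : ∀ x ∈ annulus a b, DifferentiableAt ℝ F x)
    (hdiv : IntegrableOn (divergence F) (annulus a b)) :
    ∫ x in annulus a b, divergence F x = flux F b - flux F a := by
  have hclosed : Icc (a, -Real.pi) (b, Real.pi) ⊆ polarPt ⁻¹' {x | a ≤ ‖x‖ ∧ ‖x‖ ≤ b} := by
    intro p hp
    simpa only [mem_preimage, mem_ofPred_eq, norm_polarPt, abs_of_nonneg (ha.trans hp.1.1)]
      using ⟨hp.1.1, hp.2.1⟩
  have hopen := polarCoord_target_inter_preimage_annulus (b := b) ha
  have hdiff : ∀ p ∈ Ioo a b ×ˢ Ioo (-Real.pi) Real.pi, DifferentiableAt ℝ F (polarPt p) :=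
    fun p hp => hdF _ (hopen.ge hp).2
  have hpolar : ∀ p ∈ Ioo a b ×ˢ Ioo (-Real.pi) Real.pi, p.1 * divergence F (polarPt p) =
      fderiv ℝ (polarRadial F) p (1, 0) + fderiv ℝ (polarAngular F) p (0, 1) :=
    fun p hp => (fderiv_polarRadial_add_fderiv_polarAngular (hdiff p hp)).symm
  have hmeas : MeasurableSet (Ioo a b ×ˢ Ioo (-Real.pi) Real.pi) :=
    measurableSet_Ioo.prod measurableSet_Ioo
  have hae := Icc_ae_eq_Ioo_prod a b (-Real.pi) Real.pi
  have hint := integrableOn_inter_preimage_polarPt (isOpen_annulus a b).measurableSet hdiv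
  rw [hopen] at hint
  rw [← setIntegral_polarPt (isOpen_annulus a b).measurableSet, hopen,
    setIntegral_congr_fun hmeas hpolar, ← setIntegral_congr_set hae,
    integral_divergence_prod_Icc_of_hasFDerivAt_off_countable_of_le _ _ _ _ (a, -Real.pi)
      (b, Real.pi) ⟨hab, by linarith [Real.pi_pos]⟩ ∅ countable_empty
      ((continuousOn_polarRadial hF).mono hclosed) ((continuousOn_polarAngular hF).mono hclosed)
      (fun p hp => (differentiableAt_polarRadial (hdiff p hp.1)).hasFDerivAt)
      (fun p hp => (differentiableAt_polarAngular (hdiff p hp.1)).hasFDerivAt)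
      ((integrableOn_congr_set_ae hae).2 (hint.congr_fun hpolar hmeas))]
  simp only [polarAngular_neg_pi, flux, sub_self, zero_add]

theorem sq_setIntegral_le {α : Type*} [MeasurableSpace α] {μ : Measure α} {s : Set α} {f : α → ℝ}
    (hs : μ s ≠ ⊤) (hf : IntegrableOn f s μ) (hf2 : IntegrableOn (fun x => f x ^ 2) s μ) :
    (∫ x in s, f x ∂μ) ^ 2 ≤ μ.real s * ∫ x in s, f x ^ 2 ∂μ := by
  obtain h0 | h0 := eq_or_ne (μ s) 0
  · simp [Measure.restrict_eq_zero.2 h0]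
  have hjensen := (even_two.convexOn_pow (𝕜 := ℝ)).map_set_average_le
    (continuous_pow 2).continuousOn isClosed_univ h0 hs (by simp) hf hf2
  have hpos : 0 < μ.real s := ENNReal.toReal_pos h0 hs
  simp only [setAverage_eq, smul_eq_mul] at hjensen
  field_simp at hjensen
  linarith

theorem sq_flux_le {r : ℝ} (hr : 0 ≤ r) (hF : ContinuousOn F (Metric.sphere 0 r)) :
    flux F r ^ 2 ≤ 2 * Real.pi * r *
      ∫ θ in Ioo (-Real.pi) Real.pi, r * ‖F (polarPt (r, θ))‖ ^ 2 := by
  have hmem : ∀ θ, polarPt (r, θ) ∈ Metric.sphere (0 : Plane) r := fun θ => by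
    rw [mem_sphere_zero_iff_norm, norm_polarPt, abs_of_nonneg hr]
  have hpolar : Continuous fun θ : ℝ => (r, θ) := by fun_prop
  have hrad : Continuous fun θ => polarRadial F (r, θ) :=
    (continuousOn_polarRadial hF).comp_continuous hpolar hmem
  have hnorm : Continuous fun θ => r * (r * ‖F (polarPt (r, θ))‖ ^ 2) := by
    have hcirc := hF.comp_continuous (differentiable_polarPt.continuous.comp hpolar) hmem
    exact continuous_const.mul (continuous_const.mul (hcirc.norm.pow 2))
  have hint : ∀ {f : ℝ → ℝ}, Continuous f → IntegrableOn f (Ioo (-Real.pi) Real.pi) :=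
    fun hf => (hf.integrableOn_Icc).mono_set Ioo_subset_Icc_self
  have hle : -Real.pi ≤ Real.pi := by linarith [Real.pi_pos]
  have hvol : volume.real (Ioo (-Real.pi) Real.pi) = 2 * Real.pi := by
    rw [Real.volume_real_Ioo_of_le hle]
    ring
  rw [flux, intervalIntegral.integral_of_le hle, integral_Ioc_eq_integral_Ioo, mul_assoc,
    ← integral_const_mul, ← hvol]
  refine (sq_setIntegral_le measure_Ioo_lt_top.ne (hint hrad) (hint (hrad.pow 2))).trans ?_
  refine mul_le_mul_of_nonneg_left ?_ measureReal_nonneg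
  refine setIntegral_mono (hint (hrad.pow 2)) (hint hnorm) fun θ => ?_
  have hcs := abs_real_inner_le_norm (F (polarPt (r, θ))) (circlePt θ)
  rw [norm_circlePt, mul_one] at hcs
  have hsq : inner ℝ (F (polarPt (r, θ))) (circlePt θ) ^ 2 ≤ ‖F (polarPt (r, θ))‖ ^ 2 :=
    sq_le_sq.2 (by rwa [abs_norm])
  calc polarRadial F (r, θ) ^ 2 = r ^ 2 * inner ℝ (F (polarPt (r, θ))) (circlePt θ) ^ 2 :=
        mul_pow _ _ _
    _ ≤ r ^ 2 * ‖F (polarPt (r, θ))‖ ^ 2 := by gcongr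
    _ = r * (r * ‖F (polarPt (r, θ))‖ ^ 2) := by ring

theorem isOpen_norm_gt (a : ℝ) : IsOpen {x : Plane | a < ‖x‖} :=
  isOpen_lt continuous_const continuous_norm

theorem annulus_subset_norm_gt (a b : ℝ) : annulus a b ⊆ {x | a < ‖x‖} := fun _ hx => hx.1

theorem integrableOn_circleIntegral_of_norm_gt {a : ℝ} (ha : 0 ≤ a) {f : Plane → ℝ}
    (hf : IntegrableOn f {x | a < ‖x‖}) :
    IntegrableOn (fun r => ∫ θ in Ioo (-Real.pi) Real.pi, r * f (polarPt (r, θ))) (Ioi a) := by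
  have h := integrableOn_inter_preimage_polarPt (isOpen_norm_gt a).measurableSet hf
  have hsub : Ioi a ×ˢ Ioo (-Real.pi) Real.pi
      ⊆ polarCoord.target ∩ polarPt ⁻¹' {x | a < ‖x‖} := by
    rintro ⟨r, θ⟩ ⟨hr, hθ⟩
    refine ⟨⟨ha.trans_lt hr, hθ⟩, ?_⟩
    simpa only [mem_preimage, mem_ofPred_eq, norm_polarPt, abs_of_pos (ha.trans_lt hr)]
      using mem_Ioi.1 hr
  replace h := h.mono_set hsub
  rw [IntegrableOn, Measure.volume_eq_prod, ← Measure.prod_restrict] at h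
  exact h.integral_prod_left

/-- Otherwise `g r ≥ c / r` near infinity, and `1 / r` is not integrable there. -/
theorem eq_zero_of_tendsto_of_sq_le_mul {u g : ℝ → ℝ} {a L : ℝ} (hu : Tendsto u atTop (𝓝 L))
    (hg : IntegrableOn g (Ioi a)) (hle : ∀ r, 0 < r → a < r → u r ^ 2 ≤ r * g r) : L = 0 := by
  by_contra hL
  have hL2 : 0 < L ^ 2 := by positivity
  obtain ⟨R, hR⟩ := eventually_atTop.1 <| ((hu.pow 2).eventually_const_lt (half_lt_self hL2)).and
    ((eventually_gt_atTop 0).and (eventually_gt_atTop a))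
  have hgR := (hg.mono_set (Ioi_subset_Ioi (hR R le_rfl).2.2.le)).const_mul (2 / L ^ 2)
  refine not_integrableOn_Ioi_inv (a := R) (hgR.mono' measurable_inv.aestronglyMeasurable ?_)
  refine (ae_restrict_mem measurableSet_Ioi).mono fun r hr => ?_
  obtain ⟨hur, hr0, har⟩ := hR r (le_of_lt hr)
  rw [Real.norm_of_nonneg (inv_nonneg.2 hr0.le), div_mul_eq_mul_div, inv_eq_one_div,
    div_le_div_iff₀ hr0 hL2]
  linarith [hle r hr0 har]

theorem tendsto_flux_atTop {a : ℝ} (ha : 0 ≤ a) (hF : ContinuousOn F {x | a ≤ ‖x‖})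
    (hdF : ∀ x, a < ‖x‖ → DifferentiableAt ℝ F x)
    (hdiv : IntegrableOn (divergence F) {x | a < ‖x‖}) :
    Tendsto (flux F) atTop (𝓝 ((∫ x in {x | a < ‖x‖}, divergence F x) + flux F a)) := by
  have hiUnion : ⋃ R : ℝ, annulus a R = {x | a < ‖x‖} :=
    subset_antisymm (iUnion_subset (annulus_subset_norm_gt a))
      fun x hx => mem_iUnion.2 ⟨‖x‖ + 1, hx, by simp⟩
  have hlim := tendsto_setIntegral_of_monotone (μ := volume) (f := divergence F)
    (s := annulus a) (fun R => (isOpen_annulus a R).measurableSet)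
    (fun R S hRS x hx => ⟨hx.1, hx.2.trans_le hRS⟩) (by rwa [hiUnion])
  rw [hiUnion] at hlim
  refine (hlim.add_const (flux F a)).congr' ?_
  filter_upwards [eventually_ge_atTop a] with R hR
  rw [integral_divergence_annulus ha hR (hF.mono fun x hx => hx.1) (fun x hx => hdF x hx.1)
    (hdiv.mono_set (annulus_subset_norm_gt a R)), sub_add_cancel]

/-- By Cauchy–Schwarz on circles, `flux F r ^ 2 / r` is integrable in `r`, so the flux through
infinity vanishes. -/
theorem integral_divergence_norm_gt {a : ℝ} (ha : 0 ≤ a) (hF : ContinuousOn F {x | a ≤ ‖x‖})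
    (hdF : ∀ x, a < ‖x‖ → DifferentiableAt ℝ F x)
    (hdiv : IntegrableOn (divergence F) {x | a < ‖x‖})
    (hF2 : IntegrableOn (fun x => ‖F x‖ ^ 2) {x | a < ‖x‖}) :
    ∫ x in {x | a < ‖x‖}, divergence F x = -flux F a := by
  refine eq_neg_of_add_eq_zero_left (eq_zero_of_tendsto_of_sq_le_mul
    (tendsto_flux_atTop ha hF hdF hdiv)
    ((integrableOn_circleIntegral_of_norm_gt ha hF2).const_mul (2 * Real.pi)) fun r hr har => ?_)
  have hsphere : Metric.sphere (0 : Plane) r ⊆ {x | a ≤ ‖x‖} := fun x hx =>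
    har.le.trans_eq (mem_sphere_zero_iff_norm.1 hx).symm
  refine (sq_flux_le hr.le (hF.mono hsphere)).trans_eq ?_
  ring

theorem flux_zero (F : Plane → Plane) : flux F 0 = 0 := by
  simp [flux, polarRadial]

/-- A point is removed from the disk, which changes neither side. -/
theorem integral_divergence_ball {b : ℝ} (hb : 0 ≤ b) (hF : ContinuousOn F (Metric.closedBall 0 b))
    (hdF : ∀ x ∈ Metric.ball 0 b, DifferentiableAt ℝ F x)
    (hdiv : IntegrableOn (divergence F) (Metric.ball 0 b)) :
    ∫ x in Metric.ball 0 b, divergence F x = flux F b := by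
  have hball : Metric.ball (0 : Plane) b \ {0} = annulus 0 b := by
    ext x
    simp [annulus, and_comm]
  have hann : annulus 0 b ⊆ Metric.ball 0 b := hball ▸ sdiff_subset
  rw [← setIntegral_congr_set (sdiff_null_ae_eq_self (measure_singleton 0)), hball,
    integral_divergence_annulus le_rfl hb (hF.mono fun x hx => by simpa using hx.2)
      (fun x hx => hdF x (hann hx)) (hdiv.mono_set hann), flux_zero, sub_zero]

end DivergenceTheorem

section ComplexDerivatives

variable {ι : Type*} [Finite ι] [DecidableEq ι] {f g : EuclideanSpace ℝ ι → ℂ}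
  {x : EuclideanSpace ℝ ι}

theorem partialDeriv_mul (hf : DifferentiableAt ℝ f x) (hg : DifferentiableAt ℝ g x) (i : ι) :
    partialDeriv i (fun y => f y * g y) x
      = f x * partialDeriv i g x + partialDeriv i f x * g x := by
  have := Fintype.ofFinite ι
  simp only [partialDeriv, fderiv_fun_mul hf hg]
  simp [mul_comm]

theorem partialDeriv_inv (hf : DifferentiableAt ℝ f x) (h0 : f x ≠ 0) (i : ι) :
    partialDeriv i (fun y => (f y)⁻¹) x = -((f x)⁻¹ ^ 2 * partialDeriv i f x) := by
  have := Fintype.ofFinite ι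
  have hd : HasFDerivAt (fun y => (f y)⁻¹) _ x :=
    ((hasDerivAt_inv h0).hasFDerivAt.restrictScalars ℝ).comp x hf.hasFDerivAt
  rw [partialDeriv, hd.fderiv]
  simp [partialDeriv, mul_comm]

theorem partialDeriv_conj (f : EuclideanSpace ℝ ι → ℂ) (x : EuclideanSpace ℝ ι) (i : ι) :
    partialDeriv i (fun y => conj (f y)) x = conj (partialDeriv i f x) := by
  have := Fintype.ofFinite ι
  rw [partialDeriv, show (fun y => conj (f y)) = Complex.conjCLE ∘ f from rfl,
    Complex.conjCLE.comp_fderiv]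
  rfl

end ComplexDerivatives

section PointwiseIdentities

variable {z : Plane → ℂ} {x : Plane}

/-- The complex number `∑ᵢ (∂ᵢ z)²`. -/
def derivSq (z : Plane → ℂ) (x : Plane) : ℂ := ∑ i, partialDeriv i z x ^ 2

/-- `|u ∇u + v ∇v|²` for `z = u + i v`, the contribution of the modulus of `z` to
`‖z‖² * gradSq z`. -/
def radialSq (z : Plane → ℂ) (x : Plane) : ℝ := ∑ i, inner ℝ (partialDeriv i z x) (z x) ^ 2

/-- `|u ∇v - v ∇u|²` for `z = u + i v`, the contribution of the argument of `z` to
`‖z‖² * gradSq z`. -/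
def angularSq (z : Plane → ℂ) (x : Plane) : ℝ := ∑ i, (conj (z x) * partialDeriv i z x).im ^ 2

/-- The harmonic map equation into the round sphere, in a stereographic chart:
the complex form of the Euler–Lagrange equations. -/
def HarmonicMapEqAt (z : Plane → ℂ) (x : Plane) : Prop :=
  (1 + (‖z x‖ : ℂ) ^ 2) * Laplacian.laplacian z x = 2 * conj (z x) * derivSq z x

theorem partialDeriv_uPart (hz : DifferentiableAt ℝ z x) (i : Fin 2) :
    partialDeriv i (uPart z) x = (partialDeriv i z x).re := by
  have hd : HasFDerivAt (uPart z) _ x := Complex.reCLM.hasFDerivAt.comp x hz.hasFDerivAt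
  rw [partialDeriv, hd.fderiv]
  rfl

theorem partialDeriv_vPart (hz : DifferentiableAt ℝ z x) (i : Fin 2) :
    partialDeriv i (vPart z) x = (partialDeriv i z x).im := by
  have hd : HasFDerivAt (vPart z) _ x := Complex.imCLM.hasFDerivAt.comp x hz.hasFDerivAt
  rw [partialDeriv, hd.fderiv]
  rfl

theorem laplacian_uPart (hz : ContDiffAt ℝ 2 z x) :
    Laplacian.laplacian (uPart z) x = (Laplacian.laplacian z x).re :=
  hz.laplacian_CLM_comp_left (l := Complex.reCLM)

theorem laplacian_vPart (hz : ContDiffAt ℝ 2 z x) :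
    Laplacian.laplacian (vPart z) x = (Laplacian.laplacian z x).im :=
  hz.laplacian_CLM_comp_left (l := Complex.imCLM)

theorem gradSq_eq_sum (hz : DifferentiableAt ℝ z x) :
    gradSq z x = ∑ i, ‖partialDeriv i z x‖ ^ 2 := by
  simp only [gradSq, norm_sq_gradient, ← Finset.sum_add_distrib, partialDeriv_uPart hz,
    partialDeriv_vPart hz, Complex.sq_norm, Complex.normSq_apply, ← pow_two]

theorem radialSq_add_angularSq (hz : DifferentiableAt ℝ z x) :
    radialSq z x + angularSq z x = ‖z x‖ ^ 2 * gradSq z x := by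
  rw [gradSq_eq_sum hz, radialSq, angularSq, ← Finset.sum_add_distrib, Finset.mul_sum]
  refine Finset.sum_congr rfl fun i _ => ?_
  simp only [Complex.inner, Complex.sq_norm, Complex.normSq_apply, Complex.mul_re, Complex.mul_im,
    Complex.conj_re, Complex.conj_im]
  ring

theorem re_conj_sq_mul_derivSq (z : Plane → ℂ) (x : Plane) :
    (conj (z x) ^ 2 * derivSq z x).re = radialSq z x - angularSq z x := by
  rw [derivSq, radialSq, angularSq, Finset.mul_sum, Complex.re_sum, ← Finset.sum_sub_distrib]
  refine Finset.sum_congr rfl fun i _ => ?_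
  simp only [Complex.inner, sq, Complex.mul_re, Complex.mul_im, Complex.conj_re,
    Complex.conj_im]
  ring

theorem radialSq_nonneg (z : Plane → ℂ) (x : Plane) : 0 ≤ radialSq z x :=
  Finset.sum_nonneg fun _ _ => sq_nonneg _

theorem angularSq_nonneg (z : Plane → ℂ) (x : Plane) : 0 ≤ angularSq z x :=
  Finset.sum_nonneg fun _ _ => sq_nonneg _

theorem eulerLagrangeAt_iff (hz : ContDiffAt ℝ 2 z x) :
    EulerLagrangeAt (uPart z) (vPart z) x ↔ HarmonicMapEqAt z x := by
  have hd := hz.differentiableAt two_ne_zero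
  have hN : 1 + uPart z x ^ 2 + vPart z x ^ 2 = 1 + ‖z x‖ ^ 2 := by
    rw [Complex.sq_norm, Complex.normSq_apply, uPart, vPart]
    ring
  have hN0 : (1 + ‖z x‖ ^ 2 : ℝ) ≠ 0 := by positivity
  have hu : ∀ i, partialD i (uPart z) x = (partialDeriv i z x).re := partialDeriv_uPart hd
  have hv : ∀ i, partialD i (vPart z) x = (partialDeriv i z x).im := partialDeriv_vPart hd
  have hcast : (1 + (‖z x‖ : ℂ) ^ 2) = ((1 + ‖z x‖ ^ 2 : ℝ) : ℂ) := by push_cast; rfl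
  rw [EulerLagrangeAt, HarmonicMapEqAt, hN, eq_div_iff hN0, eq_div_iff hN0, laplacian_uPart hz,
    laplacian_vPart hz, hcast, Complex.ext_iff]
  simp only [hu, hv, uPart, vPart, derivSq, Fin.sum_univ_two, Complex.mul_re, Complex.mul_im,
    Complex.add_re, Complex.add_im, Complex.ofReal_re, Complex.ofReal_im, Complex.conj_re,
    Complex.conj_im, Complex.re_ofNat, Complex.im_ofNat, pow_two]
  exact and_congr ⟨fun h => by linear_combination -h, fun h => by linear_combination -h⟩
    ⟨fun h => by linear_combination -h, fun h => by linear_combination -h⟩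

theorem uPart_smul_gradient_add_vPart_smul_gradient {K : Set Plane} (hK : K ∈ 𝓝 x)
    (hz : DifferentiableAt ℝ z x) :
    uPart z x • gradient (uPart z) x + vPart z x • gradient (vPart z) x
      = adjointDeriv K z z x := by
  ext i
  rw [adjointDeriv_apply_of_mem_nhds hK, PiLp.add_apply, PiLp.smul_apply, PiLp.smul_apply,
    gradient_apply, gradient_apply, partialDeriv_uPart hz, partialDeriv_vPart hz, Complex.inner,
    uPart, vPart]
  simp

/-- `s ↦ 2 / (1 + s)²`, the weight of the energy density as a function of `s = ‖z‖²`. -/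
def energyWeight (s : ℝ) : ℝ := 2 / (1 + s) ^ 2

theorem hasDerivAt_energyWeight {s : ℝ} (hs : 0 ≤ s) :
    HasDerivAt energyWeight (-4 / (1 + s) ^ 3) s := by
  have hs0 : 1 + s ≠ 0 := by positivity
  have h := (hasDerivAt_const s (2 : ℝ)).fun_div (((hasDerivAt_id s).const_add 1).fun_pow 2)
    (pow_ne_zero 2 hs0)
  refine h.congr_deriv ?_
  simp only [id]
  field_simp
  ring

theorem partsFirst_eq (hz : DifferentiableAt ℝ z x) :
    partsFirst z x = -8 * radialSq z x / (1 + ‖z x‖ ^ 2) ^ 3 := by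
  have hgrad := gradient_comp_norm_sq univ_mem hz (hasDerivAt_energyWeight (sq_nonneg ‖z x‖))
  simp only [energyWeight] at hgrad
  rw [partsFirst, uPart_smul_gradient_add_vPart_smul_gradient univ_mem hz, hgrad,
    real_inner_smul_left, real_inner_self_eq_norm_sq, norm_sq_adjointDeriv univ_mem, radialSq]
  ring

theorem partsSecond_eq (hz : ContDiffAt ℝ 2 z x) :
    partsSecond z x
      = 2 * inner ℝ (Laplacian.laplacian z x) (z x) / (1 + ‖z x‖ ^ 2) ^ 2 := by
  rw [partsSecond, laplacian_uPart hz, laplacian_vPart hz, Complex.inner, uPart, vPart]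
  simp

theorem inner_laplacian_of_harmonicMapEqAt (h : HarmonicMapEqAt z x) :
    (1 + ‖z x‖ ^ 2) * inner ℝ (Laplacian.laplacian z x) (z x)
      = 2 * (radialSq z x - angularSq z x) := by
  rw [← re_conj_sq_mul_derivSq, real_inner_comm, Complex.inner, ← Complex.re_ofReal_mul,
    ← Complex.re_ofReal_mul]
  congr 1
  push_cast
  rw [HarmonicMapEqAt] at h
  linear_combination conj (z x) * h

theorem partsSecond_eq_of_harmonicMapEqAt (hz : ContDiffAt ℝ 2 z x) (h : HarmonicMapEqAt z x) :
    partsSecond z x = 4 * (radialSq z x - angularSq z x) / (1 + ‖z x‖ ^ 2) ^ 3 := by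
  rw [partsSecond_eq hz, div_eq_div_iff (by positivity) (by positivity)]
  linear_combination 2 * (1 + ‖z x‖ ^ 2) ^ 2 * inner_laplacian_of_harmonicMapEqAt h

theorem logTerm_eq (hz : DifferentiableAt ℝ z x) :
    logTerm z x = 4 * radialSq z x / (1 + ‖z x‖ ^ 2) ^ 3 := by
  have hN : 1 + ‖z x‖ ^ 2 ≠ 0 := by positivity
  have hlog : HasDerivAt (fun s => Real.log (1 + s)) (1 + ‖z x‖ ^ 2)⁻¹ (‖z x‖ ^ 2) := by
    simpa using ((hasDerivAt_id (‖z x‖ ^ 2)).const_add 1).log hN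
  rw [logTerm, gradient_comp_norm_sq univ_mem hz hlog, norm_smul, mul_pow,
    norm_sq_adjointDeriv univ_mem, Real.norm_eq_abs, sq_abs, radialSq]
  field_simp
  ring

theorem gradTerm_eq (z : Plane → ℂ) (x : Plane) : gradTerm z x = 2 * energyDensity z x := by
  rw [gradTerm, energyDensity]
  ring

theorem crossTerm_eq (hz : DifferentiableAt ℝ z x) :
    crossTerm z x = 4 * angularSq z x / (1 + ‖z x‖ ^ 2) ^ 3 := by
  have hnum : uPart z x ^ 2 * ‖gradient (vPart z) x‖ ^ 2
      - 2 * uPart z x * vPart z x * inner ℝ (gradient (uPart z) x) (gradient (vPart z) x)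
      + vPart z x ^ 2 * ‖gradient (uPart z) x‖ ^ 2 = angularSq z x := by
    simp only [norm_sq_gradient, inner_gradient, angularSq, partialDeriv_uPart hz,
      partialDeriv_vPart hz, uPart, vPart, Fin.sum_univ_two, Complex.mul_im, Complex.conj_re,
      Complex.conj_im]
    ring
  rw [crossTerm, hnum, div_mul_div_comm, ← pow_succ']

theorem logTerm_add_crossTerm (hz : DifferentiableAt ℝ z x) :
    logTerm z x + crossTerm z x = 4 * (‖z x‖ ^ 2 * gradSq z x) / (1 + ‖z x‖ ^ 2) ^ 3 := by
  rw [logTerm_eq hz, crossTerm_eq hz, ← radialSq_add_angularSq hz]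
  ring

theorem neg_partsFirst_sub_partsSecond (hz : ContDiffAt ℝ 2 z x) (h : HarmonicMapEqAt z x) :
    -partsFirst z x - partsSecond z x
      = 4 * (‖z x‖ ^ 2 * gradSq z x) / (1 + ‖z x‖ ^ 2) ^ 3 := by
  have hd := hz.differentiableAt two_ne_zero
  rw [partsFirst_eq hd, partsSecond_eq_of_harmonicMapEqAt hz h, ← radialSq_add_angularSq hd]
  ring

end PointwiseIdentities

section Inversion

variable {z : Plane → ℂ} {x : Plane}

theorem inverted_eq_inv_conj (z : Plane → ℂ) : inverted z = fun x => (conj (z x))⁻¹ :=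
  funext fun _ => one_div _

theorem norm_inverted (z : Plane → ℂ) (x : Plane) : ‖inverted z x‖ = ‖z x‖⁻¹ := by
  simp [inverted]

theorem inverted_ne_zero (h0 : z x ≠ 0) : inverted z x ≠ 0 := by
  simpa [inverted] using h0

theorem contDiffOn_inverted {K : Set Plane} {n : WithTop ℕ∞} (hz : ContDiffOn ℝ n z K)
    (h0 : ∀ x ∈ K, z x ≠ 0) : ContDiffOn ℝ n (inverted z) K := by
  rw [inverted_eq_inv_conj]
  exact (Complex.conjCLE.contDiff.comp_contDiffOn hz).inv fun x hx => by simpa using h0 x hx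

theorem contDiffAt_inverted {n : WithTop ℕ∞} (hz : ContDiffAt ℝ n z x) (h0 : z x ≠ 0) :
    ContDiffAt ℝ n (inverted z) x := by
  rw [inverted_eq_inv_conj]
  exact (Complex.conjCLE.contDiff.contDiffAt.comp x hz).inv (by simpa using h0)

theorem differentiableAt_conj (hz : DifferentiableAt ℝ z x) :
    DifferentiableAt ℝ (fun y => conj (z y)) x :=
  Complex.conjCLE.differentiableAt.comp x hz

theorem partialDeriv_inverted (hz : DifferentiableAt ℝ z x) (h0 : z x ≠ 0) (i : Fin 2) :
    partialDeriv i (inverted z) x = -(inverted z x ^ 2 * conj (partialDeriv i z x)) := by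
  rw [inverted_eq_inv_conj, partialDeriv_inv (differentiableAt_conj hz) (by simpa using h0),
    partialDeriv_conj]

theorem derivSq_inverted (hz : DifferentiableAt ℝ z x) (h0 : z x ≠ 0) :
    derivSq (inverted z) x = inverted z x ^ 4 * conj (derivSq z x) := by
  simp only [derivSq, partialDeriv_inverted hz h0, map_sum, map_pow, Finset.mul_sum]
  exact Finset.sum_congr rfl fun i _ => by ring

theorem partialDeriv_partialDeriv_inverted (hz : ContDiffAt ℝ 2 z x) (h0 : z x ≠ 0) (i : Fin 2) :
    partialDeriv i (partialDeriv i (inverted z)) x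
      = 2 * inverted z x ^ 3 * conj (partialDeriv i z x ^ 2)
        - inverted z x ^ 2 * conj (partialDeriv i (partialDeriv i z) x) := by
  have hd := hz.differentiableAt two_ne_zero
  have hw := (contDiffAt_inverted hz h0).differentiableAt two_ne_zero
  have hd' := (contDiffAt_partialDeriv hz i).differentiableAt one_ne_zero
  have hlocal : partialDeriv i (inverted z)
      =ᶠ[𝓝 x] fun y => -(inverted z y * inverted z y * conj (partialDeriv i z y)) := by
    filter_upwards [hz.eventually (by simp), hd.continuousAt.eventually_ne h0] with y hy hy0
    rw [partialDeriv_inverted (hy.differentiableAt two_ne_zero) hy0, sq]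
  have hneg : partialDeriv i (partialDeriv i (inverted z)) x
      = -partialDeriv i (fun y => inverted z y * inverted z y * conj (partialDeriv i z y)) x := by
    rw [partialDeriv, hlocal.fderiv_eq, fderiv_fun_neg]
    rfl
  rw [hneg, partialDeriv_mul (hw.fun_mul hw) (differentiableAt_conj hd'), partialDeriv_mul hw hw,
    partialDeriv_conj, partialDeriv_inverted hd h0, map_pow]
  ring

theorem laplacian_inverted (hz : ContDiffAt ℝ 2 z x) (h0 : z x ≠ 0) :
    Laplacian.laplacian (inverted z) x = 2 * inverted z x ^ 3 * conj (derivSq z x)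
      - inverted z x ^ 2 * conj (Laplacian.laplacian z x) := by
  simp only [laplacian_eq_sum_partialDeriv hz,
    laplacian_eq_sum_partialDeriv (contDiffAt_inverted hz h0), derivSq,
    partialDeriv_partialDeriv_inverted hz h0, map_sum, Finset.mul_sum, Finset.sum_sub_distrib]

/-- Inversion is an isometry of the sphere, so it preserves harmonic maps. -/
theorem harmonicMapEqAt_inverted (hz : ContDiffAt ℝ 2 z x) (h0 : z x ≠ 0)
    (h : HarmonicMapEqAt z x) : HarmonicMapEqAt (inverted z) x := by
  have hd := hz.differentiableAt two_ne_zero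
  have hconj := congrArg conj h
  have hnorm : ∀ w : ℂ, (‖w‖ : ℂ) ^ 2 = w * conj w := fun w => (Complex.mul_conj' w).symm
  have hzw : conj (z x) * inverted z x = 1 := mul_one_div_cancel (by simpa using h0)
  have hwz : z x * conj (inverted z x) = 1 := by simpa using congrArg conj hzw
  simp only [HarmonicMapEqAt, hnorm, map_mul, map_add, map_one, map_ofNat, Complex.conj_conj]
    at hconj ⊢
  rw [laplacian_inverted hz h0, derivSq_inverted hd h0]
  linear_combination -(inverted z x ^ 3 * conj (inverted z x)) * hconj
    + inverted z x ^ 2 * conj (Laplacian.laplacian z x) * z x * conj (inverted z x) * hzw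
    + (inverted z x ^ 2 * conj (Laplacian.laplacian z x)
      - 2 * inverted z x ^ 3 * conj (derivSq z x)) * hwz

theorem gradSq_inverted (hz : DifferentiableAt ℝ z x) (h0 : z x ≠ 0)
    (hw : DifferentiableAt ℝ (inverted z) x) :
    gradSq (inverted z) x = gradSq z x / ‖z x‖ ^ 4 := by
  simp only [gradSq_eq_sum hz, gradSq_eq_sum hw, partialDeriv_inverted hz h0, norm_neg, norm_mul,
    norm_pow, norm_inverted, RCLike.norm_conj, Finset.sum_div]
  exact Finset.sum_congr rfl fun i _ => by ring

theorem energyDensity_inverted (hz : DifferentiableAt ℝ z x) (h0 : z x ≠ 0)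
    (hw : DifferentiableAt ℝ (inverted z) x) :
    energyDensity (inverted z) x = energyDensity z x := by
  have hn : ‖z x‖ ≠ 0 := norm_ne_zero_iff.2 h0
  have hN : 1 + ‖z x‖ ^ 2 ≠ 0 := by positivity
  have hN' : ‖z x‖ ^ 2 + 1 ≠ 0 := by positivity
  rw [energyDensity, energyDensity, gradSq_inverted hz h0 hw, norm_inverted]
  field_simp
  ring

theorem neg_partsFirst_sub_partsSecond_eq_inverted (hz : ContDiffAt ℝ 2 z x) (h0 : z x ≠ 0)
    (h : HarmonicMapEqAt z x) :
    -partsFirst z x - partsSecond z x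
      = -logTerm (inverted z) x + gradTerm (inverted z) x - crossTerm (inverted z) x := by
  have hd := hz.differentiableAt two_ne_zero
  have hw := (contDiffAt_inverted hz h0).differentiableAt two_ne_zero
  have hn : ‖z x‖ ≠ 0 := norm_ne_zero_iff.2 h0
  have hN : 1 + ‖z x‖ ^ 2 ≠ 0 := by positivity
  have hN' : ‖z x‖ ^ 2 + 1 ≠ 0 := by positivity
  have hterms := logTerm_add_crossTerm hw
  rw [gradSq_inverted hd h0 hw, norm_inverted] at hterms
  rw [neg_add_eq_sub, sub_sub, hterms, neg_partsFirst_sub_partsSecond hz h, gradTerm_eq,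
    energyDensity_inverted hd h0 hw, energyDensity]
  field_simp
  ring

end Inversion

section NorthernDomain

theorem northInterior_eq : northInterior = {x | 1 < ‖x‖} := by
  ext x
  simp [northInterior]

theorem northDomain_eq : northDomain = {x | 1 ≤ ‖x‖} := by
  ext x
  simp [northDomain, unitDisk]

theorem isOpen_northInterior : IsOpen northInterior := Metric.isClosed_closedBall.isOpen_compl

theorem northInterior_subset : northInterior ⊆ northDomain :=
  compl_subset_compl.2 Metric.ball_subset_closedBall

theorem northDomain_mem_nhds {x : Plane} (hx : x ∈ northInterior) : northDomain ∈ 𝓝 x :=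
  mem_of_superset (isOpen_northInterior.mem_nhds hx) northInterior_subset

theorem northDomain_ae_eq : northDomain =ᵐ[volume] northInterior := by
  have hsub : northDomain \ northInterior ⊆ Metric.sphere (0 : Plane) 1 := fun x hx => by
    rw [northInterior_eq, northDomain_eq, Set.mem_sdiff, mem_ofPred_eq, mem_ofPred_eq, not_lt] at hx
    simpa using le_antisymm hx.2 hx.1
  refine ae_eq_set.2 ⟨measure_mono_null hsub (Measure.addHaar_sphere volume _ _), ?_⟩
  rw [sdiff_eq_empty.2 northInterior_subset, measure_empty]

theorem integrableOn_northDomain_iff {f : Plane → ℝ} :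
    IntegrableOn f northDomain ↔ IntegrableOn f northInterior :=
  integrableOn_congr_set_ae northDomain_ae_eq

theorem setIntegral_northDomain (f : Plane → ℝ) :
    ∫ x in northDomain, f x = ∫ x in northInterior, f x :=
  setIntegral_congr_set northDomain_ae_eq

/-- Each point of the northern domain lies in a half plane contained in the northern domain. -/
theorem uniqueDiffOn_northDomain : UniqueDiffOn ℝ northDomain := by
  intro x hx
  rw [northDomain_eq, mem_ofPred_eq] at hx
  have hopen : IsOpen {y : Plane | ‖x‖ ^ 2 < inner ℝ x y} :=
    isOpen_lt continuous_const (by fun_prop)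
  have hint : (interior {y : Plane | ‖x‖ ^ 2 ≤ inner ℝ x y}).Nonempty := by
    refine ⟨(2 : ℝ) • x, mem_interior.2 ⟨_, fun y hy => (mem_ofPred_eq ▸ hy : _ < _).le, hopen, ?_⟩⟩
    rw [mem_ofPred_eq, inner_smul_right, real_inner_self_eq_norm_sq]
    nlinarith
  have hconv : Convex ℝ {y : Plane | ‖x‖ ^ 2 ≤ inner ℝ x y} :=
    convex_halfSpace_ge (innerSL ℝ x).isLinear _
  refine (uniqueDiffWithinAt_convex hconv hint
    (subset_closure (real_inner_self_eq_norm_sq x).ge)).mono fun y hy => ?_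
  have hle : ‖x‖ ^ 2 ≤ ‖x‖ * ‖y‖ := hy.trans (real_inner_le_norm x y)
  rw [northDomain_eq, mem_ofPred_eq]
  nlinarith

theorem integral_divergence_northInterior {F : Plane → Plane} (hF : ContinuousOn F northDomain)
    (hdF : ∀ x ∈ northInterior, DifferentiableAt ℝ F x)
    (hdiv : IntegrableOn (divergence F) northInterior)
    (hF2 : IntegrableOn (fun x => ‖F x‖ ^ 2) northInterior) :
    ∫ x in northInterior, divergence F x = -flux F 1 := by
  rw [northDomain_eq] at hF
  rw [northInterior_eq] at *
  exact integral_divergence_norm_gt zero_le_one hF hdF hdiv hF2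

end NorthernDomain

section EnergyField

variable {z φ : Plane → ℂ} {x : Plane} {K : Set Plane}

/-- The vector field `2 / (1 + |z|²)² (Dz)ᵀ φ`. For `φ = z` its flux through the unit circle is the
boundary integral of the integration by parts; for other `φ` it is the boundary field of the first
variation in the direction `φ`. -/
def energyField (K : Set Plane) (z φ : Plane → ℂ) (x : Plane) : Plane :=
  energyWeight (‖z x‖ ^ 2) • adjointDeriv K z φ x

theorem circleTerm_eq_flux (K : Set Plane) (z : Plane → ℂ) :
    circleTerm K z = flux (energyField K z z) 1 := by
  have hper : Function.Periodic (fun θ => 2 * inner ℝ (z (circlePt θ))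
      (fderivWithin ℝ z K (circlePt θ) (circlePt θ)) / (1 + ‖z (circlePt θ)‖ ^ 2) ^ 2)
      (2 * Real.pi) := fun θ => by
    simp only [show circlePt (θ + 2 * Real.pi) = circlePt θ by simp [circlePt]]
  have h := hper.intervalIntegral_add_eq 0 (-Real.pi)
  rw [zero_add, show -Real.pi + 2 * Real.pi = Real.pi by ring] at h
  rw [circleTerm, h, flux]
  refine intervalIntegral.integral_congr fun θ _ => ?_
  simp only [polarRadial, polarPt, energyField, one_smul, one_mul, energyWeight,
    real_inner_smul_left, inner_adjointDeriv]
  rw [real_inner_comm]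
  ring

theorem circleTerm_congr {s : Plane → ℂ} {L : Set Plane}
    (h : ∀ x ∈ Metric.sphere (0 : Plane) 1,
      s x = z x ∧ fderivWithin ℝ s K x x = fderivWithin ℝ z L x x) :
    circleTerm K s = circleTerm L z := by
  refine intervalIntegral.integral_congr fun θ _ => ?_
  obtain ⟨hval, hderiv⟩ := h (circlePt θ) (by simp [norm_circlePt])
  simp only [hval, hderiv]

theorem differentiableAt_energyWeight_norm_sq (hz : DifferentiableAt ℝ z x) :
    DifferentiableAt ℝ (fun y => energyWeight (‖z y‖ ^ 2)) x :=
  (hasDerivAt_energyWeight (sq_nonneg ‖z x‖)).differentiableAt.comp (g := energyWeight) x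
    (hz.norm_sq ℝ)

theorem divergence_energyField (hK : K ∈ 𝓝 x) (hz : ContDiffAt ℝ 2 z x)
    (hφ : DifferentiableAt ℝ φ x) :
    divergence (energyField K z φ) x
      = 2 * (inner ℝ (Laplacian.laplacian z x) (φ x)
          + ∑ i, inner ℝ (partialDeriv i z x) (partialDeriv i φ x)) / (1 + ‖z x‖ ^ 2) ^ 2
        - 8 * (∑ i, inner ℝ (partialDeriv i z x) (z x) * inner ℝ (partialDeriv i z x) (φ x))
          / (1 + ‖z x‖ ^ 2) ^ 3 := by
  have hd := hz.differentiableAt two_ne_zero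
  have hdiv := divergence_smul (differentiableAt_energyWeight_norm_sq hd)
    (differentiableAt_adjointDeriv hK hz hφ)
  have hfields : inner ℝ (adjointDeriv K z z x) (adjointDeriv K z φ x)
      = ∑ i, inner ℝ (partialDeriv i z x) (z x) * inner ℝ (partialDeriv i z x) (φ x) := by
    simp only [PiLp.inner_apply, adjointDeriv_apply_of_mem_nhds hK, RCLike.inner_apply,
      conj_trivial, mul_comm]
  rw [divergence_adjointDeriv hK hz hφ,
    gradient_comp_norm_sq hK hd (hasDerivAt_energyWeight (sq_nonneg _)), real_inner_smul_left,
    hfields] at hdiv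
  rw [show energyField K z φ = fun y => energyWeight (‖z y‖ ^ 2) • adjointDeriv K z φ y from rfl,
    hdiv, energyWeight]
  ring

theorem divergence_energyField_self (hK : K ∈ 𝓝 x) (hz : ContDiffAt ℝ 2 z x) :
    divergence (energyField K z z) x = energyDensity z x + partsFirst z x + partsSecond z x := by
  have hd := hz.differentiableAt two_ne_zero
  simp only [divergence_energyField hK hz hd, partsFirst_eq hd, partsSecond_eq hz, energyDensity,
    gradSq_eq_sum hd, radialSq, real_inner_self_eq_norm_sq, ← pow_two]
  ring

theorem norm_sq_energyField (hK : K ∈ 𝓝 x) :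
    ‖energyField K z z x‖ ^ 2 = 4 * (radialSq z x / (1 + ‖z x‖ ^ 2) ^ 4) := by
  rw [energyField, norm_smul, mul_pow, norm_sq_adjointDeriv hK, Real.norm_eq_abs, sq_abs,
    energyWeight, radialSq, div_pow, ← pow_mul]
  ring

end EnergyField

section Integrability

variable {z : Plane → ℂ} {U : Set Plane}

theorem continuousOn_partialDeriv {G : Type*} [NormedAddCommGroup G] [InnerProductSpace ℝ G]
    {f : Plane → G} (hU : IsOpen U) (hf : ContDiffOn ℝ 1 f U) (i : Fin 2) :
    ContinuousOn (partialDeriv i f) U :=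
  (hf.continuousOn_fderiv_of_isOpen hU le_rfl).clm_apply continuousOn_const

theorem continuousOn_radialSq (hU : IsOpen U) (hz : ContDiffOn ℝ 1 z U) :
    ContinuousOn (radialSq z) U :=
  continuousOn_finsetSum _ fun i _ =>
    ((continuousOn_partialDeriv hU hz i).inner hz.continuousOn).pow 2

theorem continuousOn_angularSq (hU : IsOpen U) (hz : ContDiffOn ℝ 1 z U) :
    ContinuousOn (angularSq z) U :=
  continuousOn_finsetSum _ fun i _ => (Complex.continuous_im.comp_continuousOn
    ((Complex.continuous_conj.comp_continuousOn hz.continuousOn).mul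
      (continuousOn_partialDeriv hU hz i))).pow 2

theorem gradSq_nonneg (z : Plane → ℂ) (x : Plane) : 0 ≤ gradSq z x := by
  rw [gradSq]
  positivity

theorem norm_sq_mul_gradSq_div_le {n : ℕ} (hn : 3 ≤ n) (x : Plane) :
    ‖z x‖ ^ 2 * gradSq z x / (1 + ‖z x‖ ^ 2) ^ n ≤ energyDensity z x := by
  have hN : 1 ≤ 1 + ‖z x‖ ^ 2 := le_add_of_nonneg_right (sq_nonneg _)
  have hg := gradSq_nonneg z x
  calc ‖z x‖ ^ 2 * gradSq z x / (1 + ‖z x‖ ^ 2) ^ n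
      ≤ (1 + ‖z x‖ ^ 2) * gradSq z x / (1 + ‖z x‖ ^ 2) ^ 3 := by
        gcongr
        linarith
    _ = gradSq z x / (1 + ‖z x‖ ^ 2) ^ 2 := by field_simp
    _ ≤ energyDensity z x := by
        rw [energyDensity]
        gcongr
        linarith

/-- The factor `‖z‖²` costs one power of `1 + ‖z‖²`, whence the restriction on `n`. -/
theorem integrableOn_div_of_abs_le (hU : IsOpen U) (hz : ContinuousOn z U)
    (he : IntegrableOn (energyDensity z) U) {f : Plane → ℝ} (hf : ContinuousOn f U)
    (hle : ∀ x ∈ U, |f x| ≤ ‖z x‖ ^ 2 * gradSq z x) {n : ℕ} (hn : 3 ≤ n) :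
    IntegrableOn (fun x => f x / (1 + ‖z x‖ ^ 2) ^ n) U := by
  have hcont : ContinuousOn (fun x => f x / (1 + ‖z x‖ ^ 2) ^ n) U :=
    hf.div ((continuousOn_const.add (hz.norm.pow 2)).pow n) fun x _ => by positivity
  refine he.mono' (hcont.aestronglyMeasurable hU.measurableSet)
    ((ae_restrict_mem hU.measurableSet).mono fun x hx => ?_)
  rw [Real.norm_eq_abs, abs_div, abs_of_pos (a := (1 + ‖z x‖ ^ 2) ^ n) (by positivity)]
  exact (div_le_div_of_nonneg_right (hle x hx) (by positivity)).trans
    (norm_sq_mul_gradSq_div_le hn x)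

theorem radialSq_le {x : Plane} (hz : DifferentiableAt ℝ z x) :
    |radialSq z x| ≤ ‖z x‖ ^ 2 * gradSq z x := by
  rw [abs_of_nonneg (radialSq_nonneg z x), ← radialSq_add_angularSq hz]
  exact le_add_of_nonneg_right (angularSq_nonneg z x)

theorem angularSq_le {x : Plane} (hz : DifferentiableAt ℝ z x) :
    |angularSq z x| ≤ ‖z x‖ ^ 2 * gradSq z x := by
  rw [abs_of_nonneg (angularSq_nonneg z x), ← radialSq_add_angularSq hz]
  exact le_add_of_nonneg_left (radialSq_nonneg z x)

theorem differentiableAt_of_contDiffOn {n : WithTop ℕ∞} {x : Plane} (hU : IsOpen U) (hn : n ≠ 0)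
    (hz : ContDiffOn ℝ n z U) (hx : x ∈ U) : DifferentiableAt ℝ z x :=
  (hz.contDiffAt (hU.mem_nhds hx)).differentiableAt hn

theorem integrableOn_radialSq_div (hU : IsOpen U) (hz : ContDiffOn ℝ 1 z U)
    (he : IntegrableOn (energyDensity z) U) {n : ℕ} (hn : 3 ≤ n) :
    IntegrableOn (fun x => radialSq z x / (1 + ‖z x‖ ^ 2) ^ n) U :=
  integrableOn_div_of_abs_le hU hz.continuousOn he (continuousOn_radialSq hU hz)
    (fun _ hx => radialSq_le (differentiableAt_of_contDiffOn hU one_ne_zero hz hx)) hn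

theorem integrableOn_angularSq_div (hU : IsOpen U) (hz : ContDiffOn ℝ 1 z U)
    (he : IntegrableOn (energyDensity z) U) {n : ℕ} (hn : 3 ≤ n) :
    IntegrableOn (fun x => angularSq z x / (1 + ‖z x‖ ^ 2) ^ n) U :=
  integrableOn_div_of_abs_le hU hz.continuousOn he (continuousOn_angularSq hU hz)
    (fun _ hx => angularSq_le (differentiableAt_of_contDiffOn hU one_ne_zero hz hx)) hn

theorem integrableOn_logTerm (hU : IsOpen U) (hz : ContDiffOn ℝ 1 z U)
    (he : IntegrableOn (energyDensity z) U) : IntegrableOn (logTerm z) U := by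
  refine IntegrableOn.congr_fun ((integrableOn_radialSq_div hU hz he le_rfl).const_mul 4)
    (fun x hx => ?_) hU.measurableSet
  rw [logTerm_eq (differentiableAt_of_contDiffOn hU one_ne_zero hz hx), mul_div_assoc]

theorem integrableOn_gradTerm (he : IntegrableOn (energyDensity z) U) :
    IntegrableOn (gradTerm z) U :=
  IntegrableOn.congr_fun_ae (he.const_mul 2) (.of_forall fun x => (gradTerm_eq z x).symm)

theorem integrableOn_crossTerm (hU : IsOpen U) (hz : ContDiffOn ℝ 1 z U)
    (he : IntegrableOn (energyDensity z) U) : IntegrableOn (crossTerm z) U := by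
  refine IntegrableOn.congr_fun ((integrableOn_angularSq_div hU hz he le_rfl).const_mul 4)
    (fun x hx => ?_) hU.measurableSet
  rw [crossTerm_eq (differentiableAt_of_contDiffOn hU one_ne_zero hz hx), mul_div_assoc]

theorem integrableOn_partsFirst (hU : IsOpen U) (hz : ContDiffOn ℝ 1 z U)
    (he : IntegrableOn (energyDensity z) U) : IntegrableOn (partsFirst z) U := by
  refine IntegrableOn.congr_fun ((integrableOn_radialSq_div hU hz he le_rfl).const_mul (-8))
    (fun x hx => ?_) hU.measurableSet
  rw [partsFirst_eq (differentiableAt_of_contDiffOn hU one_ne_zero hz hx), mul_div_assoc]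

theorem integrableOn_partsSecond (hU : IsOpen U) (hz : ContDiffOn ℝ 2 z U)
    (he : IntegrableOn (energyDensity z) U) (h : ∀ x ∈ U, HarmonicMapEqAt z x) :
    IntegrableOn (partsSecond z) U := by
  have hz1 := hz.of_le one_le_two
  refine IntegrableOn.congr_fun (((integrableOn_radialSq_div hU hz1 he le_rfl).sub
    (integrableOn_angularSq_div hU hz1 he le_rfl)).const_mul 4) (fun x hx => ?_)
    hU.measurableSet
  rw [partsSecond_eq_of_harmonicMapEqAt (hz.contDiffAt (hU.mem_nhds hx)) (h x hx), mul_div_assoc,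
    sub_div]
  rfl

end Integrability

section IntegrationByParts

variable {z : Plane → ℂ} {K U : Set Plane}

theorem contDiffOn_energyField {φ : Plane → ℂ} (hK : UniqueDiffOn ℝ K) (hz : ContDiffOn ℝ 2 z K)
    (hφ : ContDiffOn ℝ 1 φ K) : ContDiffOn ℝ 1 (energyField K z φ) K := by
  have hweight : ContDiffOn ℝ 1 (fun x => energyWeight (‖z x‖ ^ 2)) K :=
    contDiffOn_const.div ((contDiffOn_const.add ((hz.of_le one_le_two).norm_sq ℝ)).pow 2)
      fun x _ => by positivity
  refine hweight.smul (contDiffOn_piLp 2 |>.2 fun i => ?_)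
  exact ((hz.fderivWithin hK le_rfl).clm_apply contDiffOn_const).inner ℝ hφ

theorem integrableOn_divergence_interior {F : Plane → Plane} (hK : IsCompact K)
    (hu : UniqueDiffOn ℝ K) (hF : ContDiffOn ℝ 1 F K) :
    IntegrableOn (divergence F) (interior K) := by
  have hcont : ContinuousOn (fun x => ∑ i, fderivWithin ℝ F K x (EuclideanSpace.single i 1) i) K :=
    continuousOn_finsetSum _ fun i _ =>
      (EuclideanSpace.proj (𝕜 := ℝ) i).continuous.comp_continuousOn
        ((hF.continuousOn_fderivWithin hu le_rfl).clm_apply continuousOn_const)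
  refine ((hcont.integrableOn_compact hK).mono_set interior_subset).congr_fun (fun x hx => ?_)
    isOpen_interior.measurableSet
  simp only [divergence, partialDeriv, fderivWithin_of_mem_nhds (mem_interior_iff_mem_nhds.1 hx)]

theorem integrableOn_energyDensity_interior (hK : IsCompact K) (hu : UniqueDiffOn ℝ K)
    (hz : ContDiffOn ℝ 1 z K) : IntegrableOn (energyDensity z) (interior K) := by
  have hcont : ContinuousOn (fun x =>
      2 * ∑ i, ‖fderivWithin ℝ z K x (EuclideanSpace.single i 1)‖ ^ 2 / (1 + ‖z x‖ ^ 2) ^ 2) K := by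
    refine continuousOn_const.mul (continuousOn_finsetSum _ fun i _ => ?_)
    exact (((hz.continuousOn_fderivWithin hu le_rfl).clm_apply continuousOn_const).norm.pow 2).div
      ((continuousOn_const.add (hz.continuousOn.norm.pow 2)).pow 2) fun x _ => by positivity
  refine ((hcont.integrableOn_compact hK).mono_set interior_subset).congr_fun (fun x hx => ?_)
    isOpen_interior.measurableSet
  have hx' := mem_interior_iff_mem_nhds.1 hx
  simp only [energyDensity, gradSq_eq_sum ((hz.contDiffAt hx').differentiableAt one_ne_zero),
    partialDeriv, fderivWithin_of_mem_nhds hx', mul_div_assoc, Finset.sum_div]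

theorem setIntegral_divergence_energyField (hU : IsOpen U) (hUK : U ⊆ K) (hz : ContDiffOn ℝ 2 z K)
    (he : IntegrableOn (energyDensity z) U) (hF : IntegrableOn (partsFirst z) U)
    (hS : IntegrableOn (partsSecond z) U) :
    IntegrableOn (divergence (energyField K z z)) U ∧
      ∫ x in U, divergence (energyField K z z) x
        = (∫ x in U, energyDensity z x) + (∫ x in U, partsFirst z x)
          + ∫ x in U, partsSecond z x := by
  have hdiv : EqOn (divergence (energyField K z z)) (energyDensity z + partsFirst z + partsSecond z)
      U := fun x hx =>
    have hK := mem_of_superset (hU.mem_nhds hx) hUK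
    divergence_energyField_self hK (hz.contDiffAt hK)
  refine ⟨((he.add hF).add hS).congr_fun hdiv.symm hU.measurableSet, ?_⟩
  rw [setIntegral_congr_fun hU.measurableSet hdiv, integral_add' (he.add hF) hS,
    integral_add' he hF]

theorem energyN_eq_energyByParts (hz : ContDiffOn ℝ 2 z northDomain)
    (hfin : IntegrableOn (energyDensity z) northDomain)
    (h : ∀ x ∈ northInterior, HarmonicMapEqAt z x) :
    energyN z = energyByParts northDomain z - circleTerm northDomain z := by
  have hU := isOpen_northInterior
  have hzU := hz.mono northInterior_subset
  have hz1 := hzU.of_le one_le_two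
  have he := integrableOn_northDomain_iff.1 hfin
  obtain ⟨hint, hsplit⟩ := setIntegral_divergence_energyField hU northInterior_subset hz he
    (integrableOn_partsFirst hU hz1 he) (integrableOn_partsSecond hU hzU he h)
  have hsq : IntegrableOn (fun x => ‖energyField northDomain z z x‖ ^ 2) northInterior :=
    IntegrableOn.congr_fun
      ((integrableOn_radialSq_div hU hz1 he (n := 4) (by norm_num)).const_mul 4)
      (fun x hx => (norm_sq_energyField (northDomain_mem_nhds hx)).symm) hU.measurableSet
  have hfield := contDiffOn_energyField uniqueDiffOn_northDomain hz (hz.of_le one_le_two)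
  rw [integral_divergence_northInterior hfield.continuousOn (fun x hx => (hfield.contDiffAt
    (northDomain_mem_nhds hx)).differentiableAt one_ne_zero) hint hsq, ← circleTerm_eq_flux]
    at hsplit
  simp only [energyN, dirichletEnergy, energyByParts, setIntegral_northDomain]
  linarith

theorem energyS_eq_energyByParts (hz : ContDiffOn ℝ 2 z (Metric.closedBall 0 1)) :
    energyS z = energyByParts unitDisk z + circleTerm (Metric.closedBall 0 1) z := by
  have hball : interior (Metric.closedBall (0 : Plane) 1) = unitDisk :=
    interior_closedBall _ one_ne_zero
  have hU : IsOpen unitDisk := Metric.isOpen_ball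
  have hK := isCompact_closedBall (0 : Plane) 1
  have hsub : unitDisk ⊆ Metric.closedBall 0 1 := Metric.ball_subset_closedBall
  have hu : UniqueDiffOn ℝ (Metric.closedBall (0 : Plane) 1) :=
    uniqueDiffOn_convex (convex_closedBall _ _) (by simp [hball, unitDisk])
  have hfield := contDiffOn_energyField hu hz (hz.of_le one_le_two)
  have hnhds : ∀ x ∈ unitDisk, Metric.closedBall 0 1 ∈ 𝓝 x := fun x hx =>
    mem_of_superset (hU.mem_nhds hx) hsub
  have hint := hball ▸ integrableOn_divergence_interior hK hu hfield
  have he := hball ▸ integrableOn_energyDensity_interior hK hu (hz.of_le one_le_two)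
  have hF := integrableOn_partsFirst hU ((hz.mono hsub).of_le one_le_two) he
  have hS : IntegrableOn (partsSecond z) unitDisk := by
    refine ((hint.sub he).sub hF).congr_fun (fun x hx => ?_) hU.measurableSet
    simp only [Pi.sub_apply, divergence_energyField_self (hnhds x hx) (hz.contDiffAt (hnhds x hx))]
    ring
  have hsplit := (setIntegral_divergence_energyField hU hsub hz he hF hS).2
  rw [unitDisk, integral_divergence_ball zero_le_one hfield.continuousOn
    (fun x hx => (hfield.contDiffAt (hnhds x hx)).differentiableAt one_ne_zero) hint,
    ← circleTerm_eq_flux] at hsplit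
  rw [energyS, dirichletEnergy, energyByParts, unitDisk]
  linarith

end IntegrationByParts

section CalculusOfVariations

variable {E F : Type*} [NormedAddCommGroup E] [MeasurableSpace E] [BorelSpace E]
  {μ : Measure E} {U S : Set E}

theorem integrableOn_of_continuousOn_of_eq_zero [NormedAddCommGroup F]
    [IsFiniteMeasureOnCompacts μ] {f : E → F} (hU : MeasurableSet U) (hS : IsCompact S)
    (hSU : S ⊆ U) (hf : ContinuousOn f U) (h0 : ∀ x ∉ S, f x = 0) : IntegrableOn f U μ :=
  ((hf.mono hSU).integrableOn_compact hS).of_forall_sdiff_eq_zero hU fun x hx => h0 x hx.2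

theorem hasDerivAt_setIntegral_of_compact_support [IsFiniteMeasureOnCompacts μ]
    [SecondCountableTopology E] {F F' : ℝ → E → ℝ}
    (hU : MeasurableSet U) (hS : IsCompact S) (hSU : S ⊆ U)
    (hF0 : IntegrableOn (F 0) U μ) (hF : ∀ t, ContinuousOn (F t) U)
    (hF' : ContinuousOn (fun p : ℝ × E => F' p.1 p.2) (univ ×ˢ U))
    (hderiv : ∀ t, ∀ x ∈ U, HasDerivAt (F · x) (F' t x) t) (h0 : ∀ t, ∀ x ∉ S, F' t x = 0) :
    HasDerivAt (fun t => ∫ x in U, F t x ∂μ) (∫ x in U, F' 0 x ∂μ) 0 := by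
  obtain ⟨C, hC⟩ := (isCompact_Icc.prod hS).exists_bound_of_continuousOn
    (hF'.mono (prod_mono (subset_univ (Icc (-1) 1)) hSU))
  have hbound : ∀ x, ∀ t ∈ Ioo (-1 : ℝ) 1, ‖F' t x‖ ≤ S.indicator (fun _ => C) x := by
    intro x t ht
    by_cases hx : x ∈ S
    · rw [indicator_of_mem hx]
      exact hC (t, x) ⟨Ioo_subset_Icc_self ht, hx⟩
    · rw [indicator_of_notMem hx, h0 t x hx, norm_zero]
  have hF'0 : ContinuousOn (F' 0) U :=
    hF'.comp (f := fun x => ((0 : ℝ), x)) (by fun_prop) fun x hx => ⟨mem_univ _, hx⟩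
  refine (hasDerivAt_integral_of_dominated_loc_of_deriv_le
    (Ioo_mem_nhds neg_one_lt_zero zero_lt_one)
    (.of_forall fun t => (hF t).aestronglyMeasurable hU) hF0 (hF'0.aestronglyMeasurable hU)
    (.of_forall hbound) ?_
    ((ae_restrict_mem hU).mono fun x hx t _ => hderiv t x hx)).2
  exact ((integrable_indicator_iff hS.measurableSet).2
    (integrableOn_const hS.measure_lt_top.ne)).restrict

theorem eqOn_zero_of_setIntegral_inner_eq_zero [NormedSpace ℝ E] [FiniteDimensional ℝ E]
    [NormedAddCommGroup F] [InnerProductSpace ℝ F] [IsLocallyFiniteMeasure μ] [μ.IsOpenPosMeasure]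
    {f : E → F} (hU : IsOpen U) (hf : ContinuousOn f U)
    (h : ∀ φ : E → F, ContDiff ℝ (⊤ : ℕ∞) φ → HasCompactSupport φ → tsupport φ ⊆ U →
      ∫ x in U, inner ℝ (f x) (φ x) ∂μ = 0) : EqOn f 0 U := by
  have hcoord : ∀ c, EqOn (fun x => inner ℝ (f x) c) 0 U := by
    intro c
    have hcont : ContinuousOn (fun x => inner ℝ (f x) c) U := hf.inner continuousOn_const
    refine Measure.eqOn_open_of_ae_eq (μ := μ) ((ae_restrict_iff' hU.measurableSet).2 ?_) hU
      hcont continuousOn_const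
    refine hU.ae_eq_zero_of_integral_contDiff_smul_eq_zero
      (hcont.locallyIntegrableOn hU.measurableSet) fun g hg hgc hgU => ?_
    have hsub : tsupport (fun x => g x • c) ⊆ tsupport g := tsupport_smul_subset_left g _
    have hint := h (fun x => g x • c) (hg.smul contDiff_const)
      (hgc.of_isClosed_subset (isClosed_tsupport _) hsub) (hsub.trans hgU)
    rw [setIntegral_eq_integral_of_forall_compl_eq_zero fun x hx => by
      rw [image_eq_zero_of_notMem_tsupport fun hx' => hx (hgU hx'), zero_smul, inner_zero_right]]
      at hint
    simpa only [real_inner_smul_right, smul_eq_mul] using hint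
  exact fun x hx => inner_self_eq_zero.1 (hcoord (f x) hx)

end CalculusOfVariations

section FirstVariation

variable {z φ : Plane → ℂ} {x : Plane} {U : Set Plane}

/-- The derivative at `t = 0` of the energy density of `z + t φ`. -/
def energyVariation (z φ : Plane → ℂ) (x : Plane) : ℝ :=
  4 * (∑ i, inner ℝ (partialDeriv i z x) (partialDeriv i φ x)) / (1 + ‖z x‖ ^ 2) ^ 2
    - 8 * (∑ i, ‖partialDeriv i z x‖ ^ 2) * inner ℝ (z x) (φ x) / (1 + ‖z x‖ ^ 2) ^ 3

/-- `1 + |z|²` times the tension field of `z`, as a map into the round sphere. -/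
def tension (z : Plane → ℂ) (x : Plane) : ℂ :=
  (1 + (‖z x‖ : ℂ) ^ 2) * Laplacian.laplacian z x - 2 * conj (z x) * derivSq z x

theorem partialDeriv_add_smul (hz : DifferentiableAt ℝ z x) (hφ : DifferentiableAt ℝ φ x) (t : ℝ)
    (i : Fin 2) :
    partialDeriv i (fun y => z y + t • φ y) x = partialDeriv i z x + t • partialDeriv i φ x := by
  rw [partialDeriv, (hz.hasFDerivAt.fun_add (hφ.hasFDerivAt.fun_const_smul t)).fderiv]
  rfl

theorem energyDensity_eq (hz : DifferentiableAt ℝ z x) :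
    energyDensity z x = 2 * (∑ i, ‖partialDeriv i z x‖ ^ 2) / (1 + ‖z x‖ ^ 2) ^ 2 := by
  rw [energyDensity, gradSq_eq_sum hz]

theorem hasDerivAt_energyDensity_add_smul (hz : DifferentiableAt ℝ z x)
    (hφ : DifferentiableAt ℝ φ x) (t : ℝ) :
    HasDerivAt (fun t : ℝ => energyDensity (fun y => z y + t • φ y) x)
      (energyVariation (fun y => z y + t • φ y) φ x) t := by
  have hline : ∀ a b : ℂ, HasDerivAt (fun t : ℝ => a + t • b) b t := fun a b => by
    simpa using ((hasDerivAt_id t).smul_const b).const_add a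
  have hN : (1 + ‖z x + t • φ x‖ ^ 2) ^ 2 ≠ 0 := by positivity
  have hderiv := ((HasDerivAt.fun_sum fun i (_ : i ∈ Finset.univ) =>
    (hline (partialDeriv i z x) (partialDeriv i φ x)).norm_sq).const_mul 2).fun_div
    (((hline (z x) (φ x)).norm_sq.const_add 1).fun_pow 2) hN
  simp only [energyDensity_eq (hz.fun_add (hφ.fun_const_smul _)), energyVariation,
    partialDeriv_add_smul hz hφ]
  refine hderiv.congr_deriv ?_
  rw [← Finset.mul_sum]
  field_simp
  ring

theorem continuousOn_energyDensity (hU : IsOpen U) (hz : ContDiffOn ℝ 1 z U) :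
    ContinuousOn (energyDensity z) U := by
  refine ContinuousOn.congr ?_ fun x hx =>
    energyDensity_eq (differentiableAt_of_contDiffOn hU one_ne_zero hz hx)
  exact (continuousOn_const.mul (continuousOn_finsetSum _ fun i _ =>
    (continuousOn_partialDeriv hU hz i).norm.pow 2)).div
    ((continuousOn_const.add (hz.continuousOn.norm.pow 2)).pow 2) fun x _ => by positivity

theorem continuousOn_energyVariation (hU : IsOpen U) (hz : ContDiffOn ℝ 1 z U)
    (hφ : ContDiffOn ℝ 1 φ U) :
    ContinuousOn (fun p : ℝ × Plane => energyVariation (fun y => z y + p.1 • φ y) φ p.2)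
      (univ ×ˢ U) := by
  have hsnd : MapsTo Prod.snd (univ ×ˢ U : Set (ℝ × Plane)) U := fun p hp => hp.2
  have hφ0 := hφ.continuousOn.comp continuousOn_snd hsnd
  have hφ1 := fun i => (continuousOn_partialDeriv hU hφ i).comp continuousOn_snd hsnd
  have hz0 := (hz.continuousOn.comp continuousOn_snd hsnd).add (continuousOn_fst.smul hφ0)
  have hz1 := fun i => ((continuousOn_partialDeriv hU hz i).comp continuousOn_snd hsnd).add
    (continuousOn_fst.smul (hφ1 i))
  have hN := continuousOn_const (c := (1 : ℝ)).add (hz0.norm.pow 2)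
  refine ContinuousOn.congr
    ((((continuousOn_const (c := (4 : ℝ))).mul (continuousOn_finsetSum Finset.univ fun i _ =>
      (hz1 i).inner (𝕜 := ℝ) (hφ1 i))).div (hN.pow 2) fun p _ => ?_).sub
    ((((continuousOn_const (c := (8 : ℝ))).mul (continuousOn_finsetSum Finset.univ fun i _ =>
      (hz1 i).norm.pow 2)).mul (hz0.inner (𝕜 := ℝ) hφ0)).div (hN.pow 3) fun p _ => ?_))
    fun p hp => ?_
  iterate 2
    · simp only [Pi.add_apply, Pi.pow_apply]
      positivity
  · simp only [energyVariation, partialDeriv_add_smul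
      (differentiableAt_of_contDiffOn hU one_ne_zero hz hp.2)
      (differentiableAt_of_contDiffOn hU one_ne_zero hφ hp.2)]
    rfl

theorem energyVariation_eq_zero_of_notMem_tsupport (hx : x ∉ tsupport φ) :
    energyVariation z φ x = 0 := by
  have hD : fderiv ℝ φ x = 0 :=
    Function.notMem_support.1 fun h => hx (support_fderiv_subset ℝ h)
  simp [energyVariation, partialDeriv, hD, image_eq_zero_of_notMem_tsupport hx]

theorem hasDerivAt_energyN (hz : ContDiffOn ℝ 1 z northInterior)
    (hfin : IntegrableOn (energyDensity z) northDomain) (hφ : ContDiff ℝ 1 φ)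
    (hc : HasCompactSupport φ) (hs : tsupport φ ⊆ northInterior) :
    HasDerivAt (fun t : ℝ => energyN (fun x => z x + t • φ x))
      (∫ x in northInterior, energyVariation z φ x) 0 := by
  have hU := isOpen_northInterior
  have h := hasDerivAt_setIntegral_of_compact_support (μ := volume)
    (F := fun t => energyDensity fun y => z y + t • φ y) hU.measurableSet hc hs
    (by simpa using integrableOn_northDomain_iff.1 hfin)
    (fun t => continuousOn_energyDensity hU (hz.add (hφ.contDiffOn.const_smul t)))
    (continuousOn_energyVariation hU hz hφ.contDiffOn)
    (fun t x hx => hasDerivAt_energyDensity_add_smul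
      (differentiableAt_of_contDiffOn hU one_ne_zero hz hx) (hφ.differentiable one_ne_zero x) t)
    (fun t x hx => energyVariation_eq_zero_of_notMem_tsupport hx)
  simpa only [energyN, dirichletEnergy, setIntegral_northDomain, zero_smul, add_zero] using h

theorem energyVariation_eq {K : Set Plane} (hK : K ∈ 𝓝 x) (hz : ContDiffAt ℝ 2 z x)
    (hφ : DifferentiableAt ℝ φ x) :
    energyVariation z φ x = 2 * divergence (energyField K z φ) x
      - inner ℝ ((4 / (1 + ‖z x‖ ^ 2) ^ 3) • tension z x) (φ x) := by
  have hcubic : ∑ i, (2 * inner ℝ (partialDeriv i z x) (z x) * inner ℝ (partialDeriv i z x) (φ x)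
      - ‖partialDeriv i z x‖ ^ 2 * inner ℝ (z x) (φ x))
      = inner ℝ (conj (z x) * derivSq z x) (φ x) := by
    rw [derivSq, Finset.mul_sum, sum_inner]
    refine Finset.sum_congr rfl fun i _ => ?_
    simp only [pow_two (partialDeriv i z x), Complex.inner, Complex.sq_norm,
      Complex.normSq_apply, Complex.mul_re, Complex.mul_im, Complex.conj_re, Complex.conj_im]
    ring
  have htension : inner ℝ (tension z x) (φ x)
      = (1 + ‖z x‖ ^ 2) * inner ℝ (Laplacian.laplacian z x) (φ x)
        - 2 * inner ℝ (conj (z x) * derivSq z x) (φ x) := by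
    rw [← real_inner_smul_left, ← real_inner_smul_left, ← inner_sub_left, tension]
    congr 1
    simp [mul_assoc]
  rw [divergence_energyField hK hz hφ, real_inner_smul_left, htension, ← hcubic,
    Finset.sum_sub_distrib, ← Finset.sum_mul, energyVariation]
  simp only [mul_assoc, ← Finset.mul_sum]
  field_simp
  ring

theorem continuousOn_laplacian (hU : IsOpen U) (hz : ContDiffOn ℝ 2 z U) :
    ContinuousOn (Laplacian.laplacian z) U := by
  have hpartial : ∀ i, ContDiffOn ℝ 1 (partialDeriv i z) U := fun i x hx =>
    (contDiffAt_partialDeriv (hz.contDiffAt (hU.mem_nhds hx)) i).contDiffWithinAt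
  exact (continuousOn_finsetSum Finset.univ fun i _ =>
    continuousOn_partialDeriv hU (hpartial i) i).congr fun x hx =>
      laplacian_eq_sum_partialDeriv (hz.contDiffAt (hU.mem_nhds hx))

theorem continuousOn_tension (hU : IsOpen U) (hz : ContDiffOn ℝ 2 z U) :
    ContinuousOn (tension z) U := by
  have hderivSq : ContinuousOn (derivSq z) U := continuousOn_finsetSum _ fun i _ =>
    (continuousOn_partialDeriv hU (hz.of_le one_le_two) i).pow 2
  exact ((continuousOn_const.add ((Complex.continuous_ofReal.comp_continuousOn
    hz.continuousOn.norm).pow 2)).mul (continuousOn_laplacian hU hz)).sub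
    ((continuousOn_const.mul (Complex.continuous_conj.comp_continuousOn hz.continuousOn)).mul
      hderivSq)

theorem continuousOn_smul_tension (hU : IsOpen U) (hz : ContDiffOn ℝ 2 z U) :
    ContinuousOn (fun x => (4 / (1 + ‖z x‖ ^ 2) ^ 3) • tension z x) U :=
  (continuousOn_const.div ((continuousOn_const.add (hz.continuousOn.norm.pow 2)).pow 3)
    fun x _ => by simp only [Pi.add_apply, Pi.pow_apply]; positivity).smul
    (continuousOn_tension hU hz)

theorem setIntegral_divergence_energyField_eq_zero (hz : ContDiffOn ℝ 2 z northDomain)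
    (hφ : ContDiff ℝ 1 φ) (hc : HasCompactSupport φ) (hs : tsupport φ ⊆ northInterior) :
    IntegrableOn (divergence (energyField northDomain z φ)) northInterior ∧
      ∫ x in northInterior, divergence (energyField northDomain z φ) x = 0 := by
  have hfield := contDiffOn_energyField uniqueDiffOn_northDomain hz hφ.contDiffOn
  have hzero : ∀ x ∉ tsupport φ, energyField northDomain z φ x = 0 := fun x hx => by
    ext i
    simp [energyField, adjointDeriv, image_eq_zero_of_notMem_tsupport hx]
  have hdiv0 : ∀ x ∉ tsupport φ, divergence (energyField northDomain z φ) x = 0 := fun x hx => by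
    have hloc : energyField northDomain z φ =ᶠ[𝓝 x] fun _ => 0 :=
      mem_of_superset ((isClosed_tsupport φ).isOpen_compl.mem_nhds hx) hzero
    simp [divergence, partialDeriv, hloc.fderiv_eq]
  have hcont := continuousOn_finsetSum Finset.univ fun i _ =>
    (EuclideanSpace.proj (𝕜 := ℝ) i).continuous.comp_continuousOn (continuousOn_partialDeriv
      isOpen_northInterior (hfield.mono northInterior_subset) i)
  have hint : IntegrableOn (divergence (energyField northDomain z φ)) northInterior :=
    integrableOn_of_continuousOn_of_eq_zero isOpen_northInterior.measurableSet hc hs hcont hdiv0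
  have hsq := integrableOn_of_continuousOn_of_eq_zero (μ := volume)
    isOpen_northInterior.measurableSet hc hs
    ((hfield.continuousOn.mono northInterior_subset).norm.pow 2)
    fun x hx => by simp [hzero x hx]
  have hflux : flux (energyField northDomain z φ) 1 = 0 := by
    refine intervalIntegral.integral_zero_ae (.of_forall fun θ _ => ?_)
    have hθ : circlePt θ ∉ tsupport φ := fun h => by
      simpa [northInterior_eq, norm_circlePt] using hs h
    simp [polarRadial, polarPt, hzero _ hθ]
  refine ⟨hint, ?_⟩
  rw [integral_divergence_northInterior hfield.continuousOn (fun x hx => (hfield.contDiffAt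
    (northDomain_mem_nhds hx)).differentiableAt one_ne_zero) hint hsq, hflux, neg_zero]

theorem harmonicMapEqAt_of_isCriticalN (hz : ContDiffOn ℝ 2 z northDomain)
    (hfin : IntegrableOn (energyDensity z) northDomain) (hcrit : IsCriticalN z)
    (hx : x ∈ northInterior) : HarmonicMapEqAt z x := by
  have hU := isOpen_northInterior
  have hzU := hz.mono northInterior_subset
  have hcont := continuousOn_smul_tension hU hzU
  have hzero := eqOn_zero_of_setIntegral_inner_eq_zero (μ := volume) hU hcont
    fun φ hφ hc hs => by
      have hφ1 : ContDiff ℝ 1 φ := hφ.of_le (mod_cast le_top)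
      have hvar := (hasDerivAt_energyN (hzU.of_le one_le_two) hfin hφ1 hc hs).unique
        (hcrit φ hφ hc hs)
      obtain ⟨hint, hdiv⟩ := setIntegral_divergence_energyField_eq_zero hz hφ1 hc hs
      have htension := integrableOn_of_continuousOn_of_eq_zero (μ := volume) hU.measurableSet hc hs
        (hcont.inner (𝕜 := ℝ) hφ.continuous.continuousOn) fun x hx => by
          rw [image_eq_zero_of_notMem_tsupport hx, inner_zero_right]
      rw [setIntegral_congr_fun hU.measurableSet fun x hx => energyVariation_eq
        (northDomain_mem_nhds hx) (hz.contDiffAt (northDomain_mem_nhds hx))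
        (hφ1.differentiable one_ne_zero x), integral_sub (hint.const_mul 2) htension,
        integral_const_mul, hdiv, mul_zero, zero_sub, neg_eq_zero] at hvar
      exact hvar
  have hscale : 4 / (1 + ‖z x‖ ^ 2) ^ 3 ≠ 0 := by positivity
  exact sub_eq_zero.1 ((smul_eq_zero.1 (hzero hx)).resolve_left hscale)

end FirstVariation

section MinimalConditions

variable {w : Plane → ℂ} {x : Plane} {U : Set Plane}

theorem inner_sq_eq_of_not_linearIndependent {E : Type*} [NormedAddCommGroup E]
    [InnerProductSpace ℝ E] {a b : E} (h : ¬ LinearIndependent ℝ ![a, b]) :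
    inner ℝ a b ^ 2 = ‖a‖ ^ 2 * ‖b‖ ^ 2 := by
  by_cases ha : a = 0
  · simp [ha]
  · obtain ⟨c, rfl⟩ : ∃ c : ℝ, c • a = b := by
      simpa [LinearIndependent.pair_iff' ha] using h
    rw [inner_smul_right, real_inner_self_eq_norm_sq, norm_smul, mul_pow, mul_pow,
      Real.norm_eq_abs, sq_abs]
    ring

/-- In terms of `z = u + i v` this is `|u ∇v - v ∇u|² |u ∇v + v ∇u|² = 0`. -/
theorem angularSq_mul_eq_zero_of_minimalConditionsAt (hw : DifferentiableAt ℝ w x)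
    (h : MinimalConditionsAt (uPart w) (vPart w) x) :
    angularSq w x * ∑ i, (w x * partialDeriv i w x).im ^ 2 = 0 := by
  obtain ⟨hnorm, hdep⟩ := h
  have hgram := inner_sq_eq_of_not_linearIndependent hdep
  simp only [norm_sq_gradient, inner_gradient, partialDeriv_uPart hw, partialDeriv_vPart hw,
    Fin.sum_univ_two, uPart, vPart] at hnorm hgram
  simp only [angularSq, Fin.sum_univ_two, Complex.mul_im, Complex.conj_re, Complex.conj_im]
  linear_combination ((w x).re ^ 2 * ((partialDeriv 0 w x).im ^ 2 + (partialDeriv 1 w x).im ^ 2)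
    - (w x).im ^ 2 * ((partialDeriv 0 w x).re ^ 2 + (partialDeriv 1 w x).re ^ 2)) * hnorm
    - 4 * (w x).re ^ 2 * (w x).im ^ 2 * hgram

theorem angularSq_mul_eq_zero_of_ae_minimalConditionsAt (hU : IsOpen U) (hw : ContDiffOn ℝ 1 w U)
    (h : ∀ᵐ x ∂volume.restrict U, MinimalConditionsAt (uPart w) (vPart w) x) :
    ∀ x ∈ U, angularSq w x * ∑ i, (w x * partialDeriv i w x).im ^ 2 = 0 := by
  have hcont : ContinuousOn (fun x => ∑ i, (w x * partialDeriv i w x).im ^ 2) U :=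
    continuousOn_finsetSum _ fun i _ => (Complex.continuous_im.comp_continuousOn
      (hw.continuousOn.mul (continuousOn_partialDeriv hU hw i))).pow 2
  have hae : (fun x => angularSq w x * ∑ i, (w x * partialDeriv i w x).im ^ 2)
      =ᵐ[volume.restrict U] fun _ => 0 := by
    filter_upwards [h, ae_restrict_mem hU.measurableSet] with x hmin hx
    exact angularSq_mul_eq_zero_of_minimalConditionsAt
      (differentiableAt_of_contDiffOn hU one_ne_zero hw hx) hmin
  exact Measure.eqOn_open_of_ae_eq hae hU ((continuousOn_angularSq hU hw).mul hcont)
    continuousOn_const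

theorem angularSq_eq_sum_sub (w : Plane → ℂ) (x : Plane) :
    angularSq w x
      = ∑ i, (w x * partialDeriv i w x).im ^ 2 - (w x ^ 2).im * (derivSq w x).im := by
  rw [angularSq, derivSq, Complex.im_sum, Finset.mul_sum, ← Finset.sum_sub_distrib]
  refine Finset.sum_congr rfl fun i _ => ?_
  simp only [pow_two (w x), pow_two (partialDeriv i w x), Complex.mul_im, Complex.conj_re,
    Complex.conj_im]
  ring

theorem im_derivSq_eq_zero (hw : ContDiffAt ℝ 2 w x) (hharm : HarmonicMapEqAt w x)
    (h : ∀ᶠ y in 𝓝 x, ∀ i, (w y * partialDeriv i w y).im = 0) : (derivSq w x).im = 0 := by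
  have hd := hw.differentiableAt two_ne_zero
  have hderiv : ∀ i,
      (partialDeriv i w x ^ 2 + w x * partialDeriv i (partialDeriv i w) x).im = 0 := fun i => by
    have hd' := (contDiffAt_partialDeriv hw i).differentiableAt one_ne_zero
    have hconst : vPart (fun y => w y * partialDeriv i w y) =ᶠ[𝓝 x] fun _ => 0 :=
      h.mono fun y hy => hy i
    rw [pow_two, add_comm, ← partialDeriv_mul hd hd', ← partialDeriv_vPart (hd.fun_mul hd'),
      partialDeriv, hconst.fderiv_eq]
    simp
  have hsum : (derivSq w x).im + (w x * Laplacian.laplacian w x).im = 0 := by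
    rw [← Complex.add_im, derivSq, laplacian_eq_sum_partialDeriv hw, Finset.mul_sum,
      ← Finset.sum_add_distrib, Complex.im_sum]
    exact Finset.sum_eq_zero fun i _ => hderiv i
  have hlap : (1 + ‖w x‖ ^ 2) * (w x * Laplacian.laplacian w x).im
      = 2 * ‖w x‖ ^ 2 * (derivSq w x).im := by
    rw [← Complex.im_ofReal_mul, ← Complex.im_ofReal_mul]
    congr 1
    push_cast
    rw [HarmonicMapEqAt] at hharm
    linear_combination w x * hharm + 2 * derivSq w x * Complex.mul_conj' (w x)
  have : 1 + 3 * ‖w x‖ ^ 2 ≠ 0 := by positivity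
  refine (mul_eq_zero.1 ?_).resolve_left this
  linear_combination (1 + ‖w x‖ ^ 2) * hsum - hlap

theorem angularSq_eq_zero_of_ae_minimalConditionsAt (hU : IsOpen U) (hw : ContDiffOn ℝ 2 w U)
    (hharm : ∀ x ∈ U, HarmonicMapEqAt w x)
    (h : ∀ᵐ x ∂volume.restrict U, MinimalConditionsAt (uPart w) (vPart w) x) :
    ∀ x ∈ U, angularSq w x = 0 := by
  have hw1 := hw.of_le one_le_two
  have hprod := angularSq_mul_eq_zero_of_ae_minimalConditionsAt hU hw1 h
  intro x hx
  by_contra hne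
  have hnear : ∀ᶠ y in 𝓝 x, ∀ i, (w y * partialDeriv i w y).im = 0 := by
    filter_upwards [hU.mem_nhds hx,
      ((continuousOn_angularSq hU hw1).continuousAt (hU.mem_nhds hx)).eventually_ne hne]
      with y hy hne' i
    exact pow_eq_zero_iff two_ne_zero |>.1 ((Finset.sum_eq_zero_iff_of_nonneg
      fun i _ => sq_nonneg _).1 ((mul_eq_zero.1 (hprod y hy)).resolve_left hne') i
      (Finset.mem_univ i))
  refine hne ?_
  rw [angularSq_eq_sum_sub, im_derivSq_eq_zero (hw.contDiffAt (hU.mem_nhds hx)) (hharm x hx) hnear]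
  simp [hnear.self_of_nhds]

end MinimalConditions

section Colatitude

variable {c s : ℝ} {z : Plane → ℂ} {x : Plane} {K : Set Plane}

/-- `colatitude 0 ‖z‖²` is the spherical distance of `z` from the pole `0` of the stereographic
chart. A shift `c > 0` makes it smooth also where `z = 0`. -/
def colatitude (c s : ℝ) : ℝ := 2 * Real.arctan √(s + c)

/-- Twice the derivative of `colatitude c`. -/
def colatitudeWeight (c s : ℝ) : ℝ := 2 / (√(s + c) * (1 + (s + c)))

/-- The gradient of `colatitude c ‖z‖²`, with the derivative of `z` taken from inside `K`. -/
def colatitudeField (c : ℝ) (K : Set Plane) (z : Plane → ℂ) (x : Plane) : Plane :=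
  colatitudeWeight c (‖z x‖ ^ 2) • adjointDeriv K z z x

theorem hasDerivAt_colatitude (h : 0 < s + c) :
    HasDerivAt (colatitude c) (colatitudeWeight c s / 2) s := by
  have hsqrt : HasDerivAt (fun t => √(t + c)) (1 / (2 * √(s + c))) s :=
    ((hasDerivAt_id s).add_const c).sqrt h.ne'
  refine (hsqrt.arctan.const_mul 2).congr_deriv ?_
  rw [Real.sq_sqrt h.le, colatitudeWeight]
  field_simp

theorem hasDerivAt_colatitudeWeight (h : 0 < s + c) :
    HasDerivAt (colatitudeWeight c)
      (-(1 + 3 * (s + c)) / (√(s + c) * (s + c) * (1 + (s + c)) ^ 2)) s := by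
  have hid : HasDerivAt (fun t => t + c) 1 s := (hasDerivAt_id s).add_const c
  have hd := (hasDerivAt_const s (2 : ℝ)).fun_div
    ((hid.sqrt h.ne').fun_mul (hid.const_add 1)) (by positivity)
  refine hd.congr_deriv ?_
  have := Real.sqrt_pos.2 h
  field_simp
  rw [Real.sq_sqrt h.le]
  ring

theorem continuous_colatitude : Continuous (colatitude c) := by
  unfold colatitude
  fun_prop

theorem colatitude_nonneg : 0 ≤ colatitude c s :=
  mul_nonneg zero_le_two (Real.arctan_nonneg.2 (Real.sqrt_nonneg _))

theorem colatitude_le_pi : colatitude c s ≤ Real.pi := by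
  rw [colatitude]
  linarith [Real.arctan_lt_pi_div_two √(s + c)]

theorem differentiableAt_colatitude_norm_sq (hz : DifferentiableAt ℝ z x)
    (h : 0 < ‖z x‖ ^ 2 + c) : DifferentiableAt ℝ (fun y => colatitude c (‖z y‖ ^ 2)) x :=
  (hasDerivAt_colatitude h).differentiableAt.comp (g := colatitude c) x (hz.norm_sq ℝ)

theorem gradient_colatitude (hK : K ∈ 𝓝 x) (hz : DifferentiableAt ℝ z x) (h : 0 < ‖z x‖ ^ 2 + c) :
    gradient (fun y => colatitude c (‖z y‖ ^ 2)) x = colatitudeField c K z x := by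
  rw [gradient_comp_norm_sq hK hz (hasDerivAt_colatitude h), colatitudeField,
    mul_div_cancel₀ _ two_ne_zero]

theorem continuousOn_colatitudeField (hK : UniqueDiffOn ℝ K) (hz : ContDiffOn ℝ 1 z K)
    (h : ∀ x ∈ K, 0 < ‖z x‖ ^ 2 + c) : ContinuousOn (colatitudeField c K z) K := by
  have hs : ContinuousOn (fun x => ‖z x‖ ^ 2 + c) K := (hz.continuousOn.norm.pow 2).add_const c
  refine ContinuousOn.smul (continuousOn_const.div (hs.sqrt.mul (continuousOn_const.add hs))
    fun x hx => ?_) (continuousOn_adjointDeriv hK hz hz.continuousOn)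
  have hpos : 0 < ‖z x‖ ^ 2 + c := h x hx
  have := Real.sqrt_pos.2 hpos
  exact (mul_pos this (add_pos one_pos hpos)).ne'

theorem differentiableAt_colatitudeWeight_norm_sq (hz : DifferentiableAt ℝ z x)
    (h : 0 < ‖z x‖ ^ 2 + c) : DifferentiableAt ℝ (fun y => colatitudeWeight c (‖z y‖ ^ 2)) x :=
  (hasDerivAt_colatitudeWeight h).differentiableAt.comp (g := colatitudeWeight c) x (hz.norm_sq ℝ)

theorem differentiableAt_colatitudeField (hK : K ∈ 𝓝 x) (hz : ContDiffAt ℝ 2 z x)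
    (h : 0 < ‖z x‖ ^ 2 + c) : DifferentiableAt ℝ (colatitudeField c K z) x := by
  have hd := hz.differentiableAt two_ne_zero
  exact (differentiableAt_colatitudeWeight_norm_sq hd h).smul
    (differentiableAt_adjointDeriv hK hz hd)

theorem norm_sq_colatitudeField (hK : K ∈ 𝓝 x) (h : 0 < ‖z x‖ ^ 2 + c) :
    ‖colatitudeField c K z x‖ ^ 2
      = 4 * radialSq z x / ((‖z x‖ ^ 2 + c) * (1 + (‖z x‖ ^ 2 + c)) ^ 2) := by
  rw [colatitudeField, colatitudeWeight, norm_smul, mul_pow, norm_sq_adjointDeriv hK,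
    Real.norm_eq_abs, sq_abs, div_pow, mul_pow, Real.sq_sqrt h.le, radialSq]
  ring

theorem norm_sq_colatitudeField_le (hK : K ∈ 𝓝 x) (hz : DifferentiableAt ℝ z x) (hc : 0 ≤ c)
    (h : 0 < ‖z x‖ ^ 2 + c) : ‖colatitudeField c K z x‖ ^ 2 ≤ 2 * energyDensity z x := by
  have hg := gradSq_nonneg z x
  have hr : radialSq z x ≤ (‖z x‖ ^ 2 + c) * gradSq z x :=
    ((le_abs_self _).trans (radialSq_le hz)).trans
      (mul_le_mul_of_nonneg_right (le_add_of_nonneg_right hc) hg)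
  calc ‖colatitudeField c K z x‖ ^ 2
      = 4 * radialSq z x / ((‖z x‖ ^ 2 + c) * (1 + (‖z x‖ ^ 2 + c)) ^ 2) :=
        norm_sq_colatitudeField hK h
    _ ≤ 4 * ((‖z x‖ ^ 2 + c) * gradSq z x)
          / ((‖z x‖ ^ 2 + c) * (1 + (‖z x‖ ^ 2 + c)) ^ 2) := by gcongr
    _ = 4 * gradSq z x / (1 + (‖z x‖ ^ 2 + c)) ^ 2 := by field_simp
    _ ≤ 4 * gradSq z x / (1 + ‖z x‖ ^ 2) ^ 2 := by
        gcongr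
        exact le_add_of_nonneg_right hc
    _ = 2 * energyDensity z x := by
        rw [energyDensity]
        ring

theorem norm_sq_colatitudeField_zero (hK : K ∈ 𝓝 x) (hz : DifferentiableAt ℝ z x) (h0 : z x ≠ 0)
    (hang : angularSq z x = 0) : ‖colatitudeField 0 K z x‖ ^ 2 = 2 * energyDensity z x := by
  have hn : ‖z x‖ ≠ 0 := norm_ne_zero_iff.2 h0
  have hr : radialSq z x = ‖z x‖ ^ 2 * gradSq z x := by
    rw [← radialSq_add_angularSq hz, hang, add_zero]
  rw [norm_sq_colatitudeField hK (by positivity), hr, energyDensity, add_zero]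
  field_simp
  ring

theorem colatitudeField_eq_of_mem_nhds {L : Set Plane} (hK : K ∈ 𝓝 x) (hL : L ∈ 𝓝 x) :
    colatitudeField c K z x = colatitudeField c L z x := by
  simp only [colatitudeField, adjointDeriv, fderivWithin_of_mem_nhds hK,
    fderivWithin_of_mem_nhds hL]

theorem tendsto_colatitudeField (h0 : z x ≠ 0) :
    Tendsto (fun c => colatitudeField c K z x) (𝓝 0) (𝓝 (colatitudeField 0 K z x)) := by
  have : ‖z x‖ ≠ 0 := norm_ne_zero_iff.2 h0
  have hweight : ContinuousAt (fun c => 2 / (√(‖z x‖ ^ 2 + c) * (1 + (‖z x‖ ^ 2 + c)))) 0 := by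
    refine ContinuousAt.div (by fun_prop) (by fun_prop) ?_
    rw [add_zero]
    positivity
  exact hweight.smul continuousAt_const

/-- For a map into a single meridian, the function `colatitude 0 ‖z‖²` is an arc length
coordinate, hence harmonic. -/
theorem divergence_colatitudeField_eq_zero (hK : K ∈ 𝓝 x) (hz : ContDiffAt ℝ 2 z x)
    (h0 : z x ≠ 0) (hharm : HarmonicMapEqAt z x) (hang : angularSq z x = 0) :
    divergence (colatitudeField 0 K z) x = 0 := by
  have hd := hz.differentiableAt two_ne_zero
  have hn : 0 < ‖z x‖ := norm_pos_iff.2 h0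
  have hg : HasDerivAt (colatitudeWeight 0)
      (-(1 + 3 * ‖z x‖ ^ 2) / (‖z x‖ * ‖z x‖ ^ 2 * (1 + ‖z x‖ ^ 2) ^ 2)) (‖z x‖ ^ 2) := by
    have h := hasDerivAt_colatitudeWeight (s := ‖z x‖ ^ 2) (c := 0) (by positivity)
    simpa only [add_zero, Real.sqrt_sq hn.le] using h
  have hlap : inner ℝ (Laplacian.laplacian z x) (z x) = 2 * radialSq z x / (1 + ‖z x‖ ^ 2) := by
    rw [eq_div_iff (by positivity), mul_comm, inner_laplacian_of_harmonicMapEqAt hharm, hang,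
      sub_zero]
  have hsum : ∑ i, ‖partialDeriv i z x‖ ^ 2 = radialSq z x / ‖z x‖ ^ 2 := by
    rw [eq_div_iff (by positivity), ← gradSq_eq_sum hd, mul_comm, ← radialSq_add_angularSq hd,
      hang, add_zero]
  have hradial : ‖adjointDeriv K z z x‖ ^ 2 = radialSq z x := norm_sq_adjointDeriv hK
  refine (divergence_smul (differentiableAt_colatitudeWeight_norm_sq hd (by positivity))
    (differentiableAt_adjointDeriv hK hz hd)).trans ?_
  simp only [divergence_adjointDeriv hK hz hd, real_inner_self_eq_norm_sq, hlap, hsum,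
    gradient_comp_norm_sq hK hd hg, real_inner_smul_left, hradial]
  rw [colatitudeWeight, add_zero, Real.sqrt_sq hn.le]
  field_simp
  ring

end Colatitude

section Calibration

variable {c : ℝ} {η w : Plane → ℂ} {x : Plane}

theorem self_mem_competitorsN (hw : ContDiffOn ℝ 1 w northDomain)
    (he : IntegrableOn (energyDensity w) northDomain) : w ∈ competitorsN w :=
  ⟨hw.continuousOn, hw.mono northInterior_subset, he, fun _ _ => rfl⟩

theorem abs_inner_le_of_norm_sq_le {E : Type*} [NormedAddCommGroup E] [InnerProductSpace ℝ E]
    {a b : E} {p q : ℝ} (ha : ‖a‖ ^ 2 ≤ 2 * p) (hb : ‖b‖ ^ 2 ≤ 2 * q) :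
    |inner ℝ a b| ≤ p + q := by
  nlinarith [abs_real_inner_le_norm a b, sq_nonneg (‖a‖ - ‖b‖)]

theorem abs_inner_colatitudeField_le (hη : ContDiffOn ℝ 1 η northInterior)
    (hw : ContDiffOn ℝ 1 w northDomain) (h0 : ∀ x ∈ northDomain, w x ≠ 0) (hc : 0 < c)
    (hx : x ∈ northInterior) :
    |inner ℝ (colatitudeField c northInterior η x) (colatitudeField 0 northDomain w x)|
      ≤ energyDensity η x + energyDensity w x := by
  have hU := isOpen_northInterior
  have hw0 := h0 x (northInterior_subset hx)
  exact abs_inner_le_of_norm_sq_le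
    (norm_sq_colatitudeField_le (hU.mem_nhds hx)
      (differentiableAt_of_contDiffOn hU one_ne_zero hη hx) hc.le (by positivity))
    (norm_sq_colatitudeField_le (northDomain_mem_nhds hx) (differentiableAt_of_contDiffOn hU
      one_ne_zero (hw.mono northInterior_subset) hx) le_rfl (by positivity))

theorem continuousOn_colatitudeField_northDomain (hw : ContDiffOn ℝ 1 w northDomain)
    (h0 : ∀ x ∈ northDomain, w x ≠ 0) :
    ContinuousOn (colatitudeField 0 northDomain w) northDomain :=
  continuousOn_colatitudeField uniqueDiffOn_northDomain hw fun x hx => by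
    have := h0 x hx
    positivity

theorem integrableOn_inner_colatitudeField (hη : ContDiffOn ℝ 1 η northInterior)
    (heη : IntegrableOn (energyDensity η) northInterior) (hw : ContDiffOn ℝ 1 w northDomain)
    (h0 : ∀ x ∈ northDomain, w x ≠ 0) (hew : IntegrableOn (energyDensity w) northInterior)
    (hc : 0 < c) :
    IntegrableOn (fun x => inner ℝ (colatitudeField c northInterior η x)
      (colatitudeField 0 northDomain w x)) northInterior := by
  have hU := isOpen_northInterior
  have hcont : ContinuousOn (fun x => inner ℝ (colatitudeField c northInterior η x)
      (colatitudeField 0 northDomain w x)) northInterior :=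
    (continuousOn_colatitudeField hU.uniqueDiffOn hη fun x _ => by positivity).inner
      ((continuousOn_colatitudeField_northDomain hw h0).mono northInterior_subset)
  refine (heη.add hew).mono' (hcont.aestronglyMeasurable hU.measurableSet)
    ((ae_restrict_mem hU.measurableSet).mono fun x hx => ?_)
  exact abs_inner_colatitudeField_le hη hw h0 hc hx

/-- The field whose divergence calibrates the energy: for a harmonic map `w` into a single meridian
the second factor is divergence free, and the first factor depends on `η` only through its
values, so that the flux through the unit circle is the same for all competitors. -/
def calibrationField (c : ℝ) (η w : Plane → ℂ) (x : Plane) : Plane :=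
  colatitude c (‖η x‖ ^ 2) • colatitudeField 0 northDomain w x

theorem continuousOn_calibrationField (hη : ContinuousOn η northDomain)
    (hw : ContDiffOn ℝ 1 w northDomain) (h0 : ∀ x ∈ northDomain, w x ≠ 0) :
    ContinuousOn (calibrationField c η w) northDomain :=
  (continuous_colatitude.comp_continuousOn (hη.norm.pow 2)).smul
    (continuousOn_colatitudeField_northDomain hw h0)

theorem differentiableAt_calibrationField (hx : x ∈ northInterior) (hη : DifferentiableAt ℝ η x)
    (hw : ContDiffAt ℝ 2 w x) (h0 : w x ≠ 0) (hc : 0 < c) :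
    DifferentiableAt ℝ (calibrationField c η w) x :=
  (differentiableAt_colatitude_norm_sq hη (by positivity)).smul
    (differentiableAt_colatitudeField (northDomain_mem_nhds hx) hw (by positivity))

theorem divergence_calibrationField (hx : x ∈ northInterior) (hη : DifferentiableAt ℝ η x)
    (hw : ContDiffAt ℝ 2 w x) (h0 : w x ≠ 0) (hharm : HarmonicMapEqAt w x)
    (hang : angularSq w x = 0) (hc : 0 < c) :
    divergence (calibrationField c η w) x
      = inner ℝ (colatitudeField c northInterior η x) (colatitudeField 0 northDomain w x) := by
  have hK := northDomain_mem_nhds hx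
  have hpos : 0 < ‖η x‖ ^ 2 + c := by positivity
  refine (divergence_smul (differentiableAt_colatitude_norm_sq hη hpos)
    (differentiableAt_colatitudeField hK hw (by positivity))).trans ?_
  rw [divergence_colatitudeField_eq_zero hK hw h0 hharm hang, mul_zero, add_zero,
    gradient_colatitude (isOpen_northInterior.mem_nhds hx) hη hpos]

theorem norm_sq_calibrationField_le (hx : x ∈ northInterior) (hw : DifferentiableAt ℝ w x)
    (h0 : w x ≠ 0) : ‖calibrationField c η w x‖ ^ 2 ≤ Real.pi ^ 2 * (2 * energyDensity w x) := by
  rw [calibrationField, norm_smul, mul_pow, Real.norm_of_nonneg colatitude_nonneg]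
  gcongr
  · exact colatitude_nonneg
  · exact colatitude_le_pi
  · exact norm_sq_colatitudeField_le (northDomain_mem_nhds hx) hw le_rfl (by positivity)

theorem integrableOn_norm_sq_calibrationField (hη : ContinuousOn η northDomain)
    (hw : ContDiffOn ℝ 1 w northDomain) (h0 : ∀ x ∈ northDomain, w x ≠ 0)
    (he : IntegrableOn (energyDensity w) northInterior) :
    IntegrableOn (fun x => ‖calibrationField c η w x‖ ^ 2) northInterior := by
  have hU := isOpen_northInterior
  have hcont := (continuousOn_calibrationField (c := c) hη hw h0).mono northInterior_subset
  refine ((he.const_mul 2).const_mul (Real.pi ^ 2)).mono'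
    ((hcont.norm.pow 2).aestronglyMeasurable hU.measurableSet)
    ((ae_restrict_mem hU.measurableSet).mono fun x hx => ?_)
  rw [norm_pow, norm_norm]
  exact norm_sq_calibrationField_le hx (differentiableAt_of_contDiffOn hU one_ne_zero
    (hw.mono northInterior_subset) hx) (h0 x (northInterior_subset hx))

theorem flux_calibrationField_eq (hη : η ∈ competitorsN w) :
    flux (calibrationField c η w) 1 = flux (calibrationField c w w) 1 := by
  refine intervalIntegral.integral_congr fun θ _ => ?_
  simp only [polarRadial, polarPt, one_smul, calibrationField,
    hη.2.2.2 (circlePt θ) (by simp [norm_circlePt])]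

theorem setIntegral_inner_colatitudeField (hη : η ∈ competitorsN w)
    (hw : ContDiffOn ℝ 2 w northDomain) (h0 : ∀ x ∈ northDomain, w x ≠ 0)
    (he : IntegrableOn (energyDensity w) northDomain)
    (hharm : ∀ x ∈ northInterior, HarmonicMapEqAt w x)
    (hang : ∀ x ∈ northInterior, angularSq w x = 0) (hc : 0 < c) :
    ∫ x in northInterior,
        inner ℝ (colatitudeField c northInterior η x) (colatitudeField 0 northDomain w x)
      = -flux (calibrationField c w w) 1 := by
  have hU := isOpen_northInterior
  have hw1 := hw.of_le one_le_two
  have hew := integrableOn_northDomain_iff.1 he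
  have hdη : ∀ x ∈ northInterior, DifferentiableAt ℝ η x := fun x hx =>
    differentiableAt_of_contDiffOn hU one_ne_zero hη.2.1 hx
  have hw2 : ∀ x ∈ northInterior, ContDiffAt ℝ 2 w x := fun x hx =>
    hw.contDiffAt (northDomain_mem_nhds hx)
  have h0U : ∀ x ∈ northInterior, w x ≠ 0 := fun x hx => h0 x (northInterior_subset hx)
  have hdiv := fun x (hx : x ∈ northInterior) => divergence_calibrationField hx (hdη x hx)
    (hw2 x hx) (h0U x hx) (hharm x hx) (hang x hx) hc
  have hint := integrableOn_inner_colatitudeField hη.2.1 (integrableOn_northDomain_iff.1 hη.2.2.1)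
    hw1 h0 hew hc
  rw [← flux_calibrationField_eq hη, ← setIntegral_congr_fun hU.measurableSet hdiv]
  exact integral_divergence_northInterior (continuousOn_calibrationField hη.1 hw1 h0)
    (fun x hx => differentiableAt_calibrationField hx (hdη x hx) (hw2 x hx) (h0U x hx) hc)
    (hint.congr_fun (fun x hx => (hdiv x hx).symm) hU.measurableSet)
    (integrableOn_norm_sq_calibrationField hη.1 hw1 h0 hew)

theorem tendsto_setIntegral_inner_colatitudeField (hw : ContDiffOn ℝ 1 w northDomain)
    (h0 : ∀ x ∈ northDomain, w x ≠ 0) (he : IntegrableOn (energyDensity w) northInterior)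
    (hang : ∀ x ∈ northInterior, angularSq w x = 0) :
    Tendsto (fun c => ∫ x in northInterior,
        inner ℝ (colatitudeField c northInterior w x) (colatitudeField 0 northDomain w x))
      (𝓝[>] 0) (𝓝 (2 * energyN w)) := by
  have hU := isOpen_northInterior
  have hw1 := hw.mono northInterior_subset
  have h0U : ∀ x ∈ northInterior, w x ≠ 0 := fun x hx => h0 x (northInterior_subset hx)
  have hfield : ∀ x ∈ northInterior,
      ‖colatitudeField 0 northInterior w x‖ ^ 2 = 2 * energyDensity w x := fun x hx =>
    norm_sq_colatitudeField_zero (hU.mem_nhds hx)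
      (differentiableAt_of_contDiffOn hU one_ne_zero hw1 hx) (h0U x hx) (hang x hx)
  have hlimit : ∫ x in northInterior, inner ℝ (colatitudeField 0 northInterior w x)
      (colatitudeField 0 northDomain w x) = 2 * energyN w := by
    rw [energyN, dirichletEnergy, setIntegral_northDomain, ← integral_const_mul]
    refine setIntegral_congr_fun hU.measurableSet fun x hx => ?_
    simp only [colatitudeField_eq_of_mem_nhds (northDomain_mem_nhds hx) (hU.mem_nhds hx),
      real_inner_self_eq_norm_sq, hfield x hx]
  rw [← hlimit]
  refine tendsto_integral_filter_of_dominated_convergence (fun x => 2 * energyDensity w x)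
    (eventually_mem_nhdsWithin.mono fun c hc => (integrableOn_inner_colatitudeField hw1 he hw h0 he
      hc).aestronglyMeasurable) ?_ (he.const_mul 2) ?_
  · filter_upwards [self_mem_nhdsWithin] with c hc
    filter_upwards [ae_restrict_mem hU.measurableSet] with x hx
    rw [Real.norm_eq_abs, two_mul]
    exact abs_inner_colatitudeField_le hw1 hw h0 hc hx
  · filter_upwards [ae_restrict_mem hU.measurableSet] with x hx
    exact ((tendsto_colatitudeField (h0U x hx)).mono_left nhdsWithin_le_nhds).inner
      tendsto_const_nhds

theorem isMinOn_energyN (hw : ContDiffOn ℝ 2 w northDomain) (h0 : ∀ x ∈ northDomain, w x ≠ 0)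
    (he : IntegrableOn (energyDensity w) northDomain)
    (hharm : ∀ x ∈ northInterior, HarmonicMapEqAt w x)
    (hang : ∀ x ∈ northInterior, angularSq w x = 0) : IsMinOn energyN (competitorsN w) w := by
  intro η hη
  have hw1 := hw.of_le one_le_two
  have hew := integrableOn_northDomain_iff.1 he
  have heη := integrableOn_northDomain_iff.1 hη.2.2.1
  have hbound : ∀ c > 0, ∫ x in northInterior,
      inner ℝ (colatitudeField c northInterior w x) (colatitudeField 0 northDomain w x)
        ≤ energyN η + energyN w := fun c hc => by
    rw [setIntegral_inner_colatitudeField (self_mem_competitorsN hw1 he) hw h0 he hharm hang hc,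
      ← setIntegral_inner_colatitudeField hη hw h0 he hharm hang hc, energyN, energyN,
      dirichletEnergy, dirichletEnergy, setIntegral_northDomain, setIntegral_northDomain,
      ← integral_add heη hew]
    exact setIntegral_mono_on (integrableOn_inner_colatitudeField hη.2.1 heη hw1 h0 hew hc)
      (heη.add hew) isOpen_northInterior.measurableSet fun x hx =>
        (le_abs_self _).trans (abs_inner_colatitudeField_le hη.2.1 hw1 h0 hc hx)
  have hlim := le_of_tendsto (tendsto_setIntegral_inner_colatitudeField hw1 h0 hew hang)
    (eventually_mem_nhdsWithin.mono hbound)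
  change energyN w ≤ energyN η
  linarith

end Calibration

section NorthernInversion

variable {z w : Plane → ℂ}

theorem differentiableAt_northInterior {x : Plane} (hz : ContDiffOn ℝ 1 z northDomain)
    (hx : x ∈ northInterior) : DifferentiableAt ℝ z x :=
  (hz.contDiffAt (northDomain_mem_nhds hx)).differentiableAt one_ne_zero

theorem harmonicMapEqAt_inverted_northInterior (hz : ContDiffOn ℝ 2 z northDomain)
    (h0 : ∀ x ∈ northDomain, z x ≠ 0) (h : ∀ x ∈ northInterior, HarmonicMapEqAt z x) :
    ∀ x ∈ northInterior, HarmonicMapEqAt (inverted z) x := fun x hx =>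
  harmonicMapEqAt_inverted (hz.contDiffAt (northDomain_mem_nhds hx))
    (h0 x (northInterior_subset hx)) (h x hx)

theorem eqOn_energyDensity_inverted (hz : ContDiffOn ℝ 1 z northDomain)
    (h0 : ∀ x ∈ northDomain, z x ≠ 0) :
    EqOn (energyDensity (inverted z)) (energyDensity z) northInterior := fun x hx =>
  energyDensity_inverted (differentiableAt_northInterior hz hx) (h0 x (northInterior_subset hx))
    (differentiableAt_northInterior (contDiffOn_inverted hz h0) hx)

theorem integrableOn_energyDensity_inverted (hz : ContDiffOn ℝ 1 z northDomain)
    (h0 : ∀ x ∈ northDomain, z x ≠ 0) (he : IntegrableOn (energyDensity z) northDomain) :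
    IntegrableOn (energyDensity (inverted z)) northDomain :=
  integrableOn_northDomain_iff.2 ((integrableOn_northDomain_iff.1 he).congr_fun
    (eqOn_energyDensity_inverted hz h0).symm isOpen_northInterior.measurableSet)

theorem energyN_inverted (hz : ContDiffOn ℝ 1 z northDomain)
    (h0 : ∀ x ∈ northDomain, z x ≠ 0) : energyN (inverted z) = energyN z := by
  rw [energyN, energyN, dirichletEnergy, dirichletEnergy, setIntegral_northDomain,
    setIntegral_northDomain]
  exact setIntegral_congr_fun isOpen_northInterior.measurableSet (eqOn_energyDensity_inverted hz h0)

theorem integrableOn_northDomain_energyTerms (hw : ContDiffOn ℝ 1 w northDomain)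
    (he : IntegrableOn (energyDensity w) northDomain) :
    IntegrableOn (logTerm w) northDomain ∧ IntegrableOn (gradTerm w) northDomain ∧
      IntegrableOn (crossTerm w) northDomain := by
  have hU := isOpen_northInterior
  have hwU := hw.mono northInterior_subset
  have heU := integrableOn_northDomain_iff.1 he
  exact ⟨integrableOn_northDomain_iff.2 (integrableOn_logTerm hU hwU heU),
    integrableOn_gradTerm he, integrableOn_northDomain_iff.2 (integrableOn_crossTerm hU hwU heU)⟩

theorem integrableOn_northDomain_partsTerms (hz : ContDiffOn ℝ 2 z northDomain)
    (he : IntegrableOn (energyDensity z) northDomain)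
    (h : ∀ x ∈ northInterior, HarmonicMapEqAt z x) :
    IntegrableOn (partsFirst z) northDomain ∧ IntegrableOn (partsSecond z) northDomain := by
  have hU := isOpen_northInterior
  have hzU := hz.mono northInterior_subset
  have heU := integrableOn_northDomain_iff.1 he
  exact ⟨integrableOn_northDomain_iff.2
      (integrableOn_partsFirst hU (hzU.of_le one_le_two) heU),
    integrableOn_northDomain_iff.2 (integrableOn_partsSecond hU hzU heU h)⟩

theorem energyByParts_eq_inverted (hz : ContDiffOn ℝ 2 z northDomain)
    (h0 : ∀ x ∈ northDomain, z x ≠ 0) (he : IntegrableOn (energyDensity z) northDomain)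
    (h : ∀ x ∈ northInterior, HarmonicMapEqAt z x) :
    energyByParts northDomain z = (∫ x in northDomain, -logTerm (inverted z) x)
      + (∫ x in northDomain, gradTerm (inverted z) x)
      - ∫ x in northDomain, crossTerm (inverted z) x := by
  have hz1 := hz.of_le one_le_two
  obtain ⟨hlog, hgrad, hcross⟩ := integrableOn_northDomain_energyTerms
    (contDiffOn_inverted hz1 h0) (integrableOn_energyDensity_inverted hz1 h0 he)
  obtain ⟨hfirst, hsecond⟩ := integrableOn_northDomain_partsTerms hz he h
  rw [energyByParts, ← integral_neg, ← integral_sub hfirst.fun_neg hsecond,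
    ← integral_add hlog.fun_neg hgrad, ← integral_sub (hlog.fun_neg.fun_add hgrad) hcross,
    setIntegral_northDomain, setIntegral_northDomain]
  exact setIntegral_congr_fun isOpen_northInterior.measurableSet fun x hx =>
    neg_partsFirst_sub_partsSecond_eq_inverted (hz.contDiffAt (northDomain_mem_nhds hx))
      (h0 x (northInterior_subset hx)) (h x hx)

theorem setIntegral_crossTerm_eq_zero (hw : ContDiffOn ℝ 1 w northDomain)
    (hang : ∀ x ∈ northInterior, angularSq w x = 0) : ∫ x in northDomain, crossTerm w x = 0 := by
  rw [setIntegral_northDomain]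
  refine setIntegral_eq_zero_of_forall_eq_zero fun x hx => ?_
  rw [crossTerm_eq (differentiableAt_northInterior hw hx), hang x hx, mul_zero, zero_div]

end NorthernInversion

end

theorem mainTheorem4 (z ζ : Plane → ℂ)
    (hz : ContDiffOn ℝ 2 z northDomain)
    (hz0 : ∀ x ∈ northDomain, z x ≠ 0)
    (hfin : IntegrableOn (energyDensity z) northDomain)
    (hcrit : IsCriticalN z)
    (hζ : ζ = inverted z) :
    -- the Euler–Lagrange equations
    (∀ x ∈ northInterior, EulerLagrangeAt (uPart ζ) (vPart ζ) x) ∧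
    -- all integrals below converge
    (IntegrableOn (energyDensity ζ) northDomain ∧
      IntegrableOn (logTerm ζ) northDomain ∧
      IntegrableOn (gradTerm ζ) northDomain ∧
      IntegrableOn (crossTerm ζ) northDomain ∧
      IntegrableOn (partsFirst z) northDomain ∧
      IntegrableOn (partsSecond z) northDomain) ∧
    -- the energy in terms of the inverted map, and its integration by parts
    energyN ζ = energyN z ∧
    energyN ζ = energyByParts northDomain z - circleTerm northDomain z ∧
    -- the decomposition, for the energy without its boundary integral
    energyByParts northDomain z =
      (∫ x in northDomain, -logTerm ζ x) + (∫ x in northDomain, gradTerm ζ x)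
        - ∫ x in northDomain, crossTerm ζ x ∧
    -- the boundary integrals cancel in the total energy
    (∀ s : Plane → ℂ, ContDiffOn ℝ 2 s (Metric.closedBall 0 1) →
      (∀ x ∈ Metric.sphere (0 : Plane) 1, s x = z x ∧
        fderivWithin ℝ s (Metric.closedBall 0 1) x x = fderivWithin ℝ z northDomain x x) →
      energyS s + energyN ζ = energyByParts unitDisk s +
        ((∫ x in northDomain, -logTerm ζ x) + (∫ x in northDomain, gradTerm ζ x)
          - ∫ x in northDomain, crossTerm ζ x)) ∧
    -- the minimal conditions
    ((∀ᵐ x ∂(volume.restrict northDomain), MinimalConditionsAt (uPart ζ) (vPart ζ) x) →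
      (ζ ∈ competitorsN ζ ∧ IsMinOn energyN (competitorsN ζ) ζ) ∧
      energyByParts northDomain z =
        -(∫ x in northDomain, logTerm ζ x) + ∫ x in northDomain, gradTerm ζ x ∧
      energyN ζ =
        -(∫ x in northDomain, logTerm ζ x) + (∫ x in northDomain, gradTerm ζ x)
          - circleTerm northDomain z) := by
  subst hζ
  have hz1 := hz.of_le one_le_two
  have hζ := contDiffOn_inverted hz hz0
  have hζ1 := hζ.of_le one_le_two
  have hharm := fun x hx => harmonicMapEqAt_of_isCriticalN (x := x) hz hfin hcrit hx
  have hharmζ := harmonicMapEqAt_inverted_northInterior hz hz0 hharm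
  have heζ := integrableOn_energyDensity_inverted hz1 hz0 hfin
  obtain ⟨hlog, hgrad, hcross⟩ := integrableOn_northDomain_energyTerms hζ1 heζ
  have hE := energyN_inverted hz1 hz0
  have hparts := hE.trans (energyN_eq_energyByParts hz hfin hharm)
  have hdec := energyByParts_eq_inverted hz hz0 hfin hharm
  refine ⟨fun x hx => (eulerLagrangeAt_iff (hζ.contDiffAt (northDomain_mem_nhds hx))).2
      (hharmζ x hx), ⟨heζ, hlog, hgrad, hcross, integrableOn_northDomain_partsTerms hz hfin hharm⟩,
    hE, hparts, hdec, fun s hs hsz => ?_, fun hmin => ?_⟩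
  · rw [energyS_eq_energyByParts hs, circleTerm_congr hsz, hparts, hdec]
    ring
  · rw [Measure.restrict_congr_set northDomain_ae_eq] at hmin
    have hang := angularSq_eq_zero_of_ae_minimalConditionsAt isOpen_northInterior
      (hζ.mono northInterior_subset) hharmζ hmin
    rw [setIntegral_crossTerm_eq_zero hζ1 hang, sub_zero, integral_neg] at hdec
    exact ⟨⟨self_mem_competitorsN hζ1 heζ, isMinOn_energyN hζ
      (fun x hx => inverted_ne_zero (hz0 x hx)) heζ hharmζ hang⟩, hdec, by rw [hparts, hdec]⟩
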